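/- Let $P$ be a set of $n$ points in the interior of an axis-aligned rectangle $R$, no two sharing an $x$- or a $y$-coordinate, each with a color from a finite color set $C$. A \emph{labeling with finite backbones} of $P$ consists of finitely many labels $l$ on the right side of $R$, each with a color $c(l)$ and a height $y(l)$, together with an assignment of each point of $P$ to a label of the same color. The \emph{leader} of a label $l$ is the union of its \emph{backbone}, i.e. the horizontal segment at height $y(l)$ from the $x$-coordinate of the leftmost point assigned to $l$ to the right side of $R$, and of the vertical segments that connect the points assigned to $l$ to this backbone (it is empty if no point is assigned to $l$). The labeling is \emph{crossing-free} if the leaders of distinct labels are disjoint (they neither overlap nor cross); the number of labels is not restricted. There is an algorithm (for the real RAM with unit-cost arithmetic and comparisons on real numbers and on integers of $O(\log(n+|C|))$ bits) that, given $R$, the points of $P$ in any order and their colors (encoded as the integers $0,\dots,|C|-1$), computes a crossing-free labeling of $P$ with finite backbones, i.e. the labels and the assignment, that has the minimum number of labels among all crossing-free labelings of $P$ with finite backbones. Its running time for $n\ge 1$ is $O(n^4|C|^2)$. -/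

import Mathlib

namespace Backbone

/-! ### Backbone labelings with finite backbones -/

/-- An input with `n` points and color set `Fin m`: an axis-aligned rectangle, points inside it
(so that labels can be placed above and below all points), no two of which share an `x`- or
`y`-coordinate, and their colors. The points come in arbitrary order. -/
structure ColoredPoints (n m : ℕ) where
  xmin : ℝ
  xmax : ℝ
  ymin : ℝ
  ymax : ℝ
  pt : Fin n → ℝ × ℝ
  color : Fin n → Fin m
  pt_mem : ∀ i, pt i ∈ Set.Ioo xmin xmax ×ˢ Set.Ioo ymin ymax
  x_injective : Function.Injective fun i => (pt i).1
  y_injective : Function.Injective fun i => (pt i).2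

/-- A collection of `numLabels` colored labels, each given by its color and the `y`-coordinate of
its backbone, together with an assignment of the points to the labels. -/
structure Labeling (n m : ℕ) where
  numLabels : ℕ
  color : Fin numLabels → Fin m
  y : Fin numLabels → ℝ
  assign : Fin n → Fin numLabels

namespace ColoredPoints

variable {n m : ℕ} (I : ColoredPoints n m) (L : Labeling n m)

/-- The finite backbone of label `l`: the horizontal segment at height `y(l)` from the leftmost
point assigned to `l` to the right side of the rectangle (empty if no point is assigned). -/
def backbone (l : Fin L.numLabels) : Set (ℝ × ℝ) :=
  {z | z.2 = L.y l ∧ z.1 ≤ I.xmax ∧ ∃ i, L.assign i = l ∧ (I.pt i).1 ≤ z.1}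

/-- The vertical segment that connects point `i` to the backbone of its label. -/
def connector (i : Fin n) : Set (ℝ × ℝ) :=
  {z | z.1 = (I.pt i).1 ∧ z.2 ∈ Set.uIcc (I.pt i).2 (L.y (L.assign i))}

/-- The backbone leader of label `l`, as a subset of the plane. -/
def leader (l : Fin L.numLabels) : Set (ℝ × ℝ) :=
  I.backbone L l ∪ ⋃ i ∈ {i : Fin n | L.assign i = l}, I.connector L i

/-- Crossing-free feasible labelings (no bound on the number of labels): all labels lie on the
right side of the rectangle, each point is assigned to a label of its own color, and the leaders
of distinct labels neither overlap nor cross, i.e. they are disjoint. -/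
structure IsCrossingFree : Prop where
  y_mem : ∀ l, L.y l ∈ Set.Icc I.ymin I.ymax
  color_eq : ∀ i, L.color (L.assign i) = I.color i
  disjoint : ∀ l l', l ≠ l' → Disjoint (I.leader L l) (I.leader L l')

/-- A crossing-free feasible labeling with the minimum number of labels. -/
def IsOptimal : Prop :=
  I.IsCrossingFree L ∧ ∀ L' : Labeling n m, I.IsCrossingFree L' → L.numLabels ≤ L'.numLabels

end ColoredPoints

/-! ### The real RAM

A random access machine with word-size integers and with real numbers. Integers below the word
bound `W` and reals are kept apart: there are finitely many scalar variables and arrays of either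
sort in a program, indices are integers, and there is no conversion (in particular no rounding)
from reals to integers. Every operation, memory access and test costs one unit of time. -/

/-- The contents of integer variables, integer arrays, real variables and real arrays. -/
structure State where
  ivar : ℕ → ℕ
  imem : ℕ → ℕ → ℕ
  rvar : ℕ → ℝ
  rmem : ℕ → ℕ → ℝ

/-- Integer expressions; `read a i` is the entry of array `a` at index `i`. -/
inductive IExp where
  | const (c : ℕ)
  | var (v : ℕ)
  | read (a : ℕ) (i : IExp)
  | add (e f : IExp)
  | sub (e f : IExp)
  | mul (e f : IExp)
  | div (e f : IExp)
  | mod (e f : IExp)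

namespace IExp

def eval (s : State) : IExp → ℕ
  | const c => c
  | var v => s.ivar v
  | read a i => s.imem a (i.eval s)
  | add e f => e.eval s + f.eval s
  | sub e f => e.eval s - f.eval s
  | mul e f => e.eval s * f.eval s
  | div e f => e.eval s / f.eval s
  | mod e f => e.eval s % f.eval s

/-- The expression can be evaluated on a machine with word bound `W`: no (intermediate) value
overflows and there is no division by zero. -/
def Fits (W : ℕ) (s : State) : IExp → Prop
  | const c => c < W
  | var v => s.ivar v < W
  | read a i => i.Fits W s ∧ s.imem a (i.eval s) < W
  | add e f => e.Fits W s ∧ f.Fits W s ∧ e.eval s + f.eval s < W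
  | sub e f => e.Fits W s ∧ f.Fits W s
  | mul e f => e.Fits W s ∧ f.Fits W s ∧ e.eval s * f.eval s < W
  | div e f => e.Fits W s ∧ f.Fits W s ∧ f.eval s ≠ 0
  | mod e f => e.Fits W s ∧ f.Fits W s ∧ f.eval s ≠ 0

/-- Time to evaluate: one unit for each constant, access and operation. -/
def cost : IExp → ℕ
  | const _ => 1
  | var _ => 1
  | read _ i => i.cost + 1
  | add e f => e.cost + f.cost + 1
  | sub e f => e.cost + f.cost + 1
  | mul e f => e.cost + f.cost + 1
  | div e f => e.cost + f.cost + 1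
  | mod e f => e.cost + f.cost + 1

end IExp

/-- Real expressions. -/
inductive RExp where
  | const (q : ℚ)
  | var (v : ℕ)
  | read (a : ℕ) (i : IExp)
  | add (e f : RExp)
  | sub (e f : RExp)
  | mul (e f : RExp)
  | div (e f : RExp)

namespace RExp

noncomputable def eval (s : State) : RExp → ℝ
  | const q => (q : ℝ)
  | var v => s.rvar v
  | read a i => s.rmem a (i.eval s)
  | add e f => e.eval s + f.eval s
  | sub e f => e.eval s - f.eval s
  | mul e f => e.eval s * f.eval s
  | div e f => e.eval s / f.eval s

def Fits (W : ℕ) (s : State) : RExp → Prop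
  | const _ => True
  | var _ => True
  | read _ i => i.Fits W s
  | add e f => e.Fits W s ∧ f.Fits W s
  | sub e f => e.Fits W s ∧ f.Fits W s
  | mul e f => e.Fits W s ∧ f.Fits W s
  | div e f => e.Fits W s ∧ f.Fits W s ∧ f.eval s ≠ 0

def cost : RExp → ℕ
  | const _ => 1
  | var _ => 1
  | read _ i => i.cost + 1
  | add e f => e.cost + f.cost + 1
  | sub e f => e.cost + f.cost + 1
  | mul e f => e.cost + f.cost + 1
  | div e f => e.cost + f.cost + 1

end RExp

/-- Tests: comparisons of integers and of reals, and their Boolean combinations. -/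
inductive Test where
  | ilt (e f : IExp)
  | ieq (e f : IExp)
  | rlt (e f : RExp)
  | req (e f : RExp)
  | not (b : Test)
  | and (b c : Test)
  | or (b c : Test)

namespace Test

def Holds (s : State) : Test → Prop
  | ilt e f => e.eval s < f.eval s
  | ieq e f => e.eval s = f.eval s
  | rlt e f => e.eval s < f.eval s
  | req e f => e.eval s = f.eval s
  | not b => ¬ b.Holds s
  | and b c => b.Holds s ∧ c.Holds s
  | or b c => b.Holds s ∨ c.Holds s

def Fits (W : ℕ) (s : State) : Test → Prop
  | ilt e f => e.Fits W s ∧ f.Fits W s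
  | ieq e f => e.Fits W s ∧ f.Fits W s
  | rlt e f => e.Fits W s ∧ f.Fits W s
  | req e f => e.Fits W s ∧ f.Fits W s
  | not b => b.Fits W s
  | and b c => b.Fits W s ∧ c.Fits W s
  | or b c => b.Fits W s ∧ c.Fits W s

def cost : Test → ℕ
  | ilt e f => e.cost + f.cost + 1
  | ieq e f => e.cost + f.cost + 1
  | rlt e f => e.cost + f.cost + 1
  | req e f => e.cost + f.cost + 1
  | not b => b.cost + 1
  | and b c => b.cost + c.cost + 1
  | or b c => b.cost + c.cost + 1

end Test

/-- Programs: assignments to variables (`iset`, `rset`) and to array entries (`iwrite`,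
`rwrite`), sequencing, branching and while-loops. -/
inductive Prog where
  | skip
  | iset (v : ℕ) (e : IExp)
  | iwrite (a : ℕ) (i e : IExp)
  | rset (v : ℕ) (e : RExp)
  | rwrite (a : ℕ) (i : IExp) (e : RExp)
  | seq (p q : Prog)
  | ite (b : Test) (p q : Prog)
  | loop (b : Test) (p : Prog)

namespace State

def setI (s : State) (v x : ℕ) : State :=
  { s with ivar := Function.update s.ivar v x }

def writeI (s : State) (a i x : ℕ) : State :=
  { s with imem := Function.update s.imem a (Function.update (s.imem a) i x) }

def setR (s : State) (v : ℕ) (x : ℝ) : State :=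
  { s with rvar := Function.update s.rvar v x }

def writeR (s : State) (a i : ℕ) (x : ℝ) : State :=
  { s with rmem := Function.update s.rmem a (Function.update (s.rmem a) i x) }

end State

/-- `Exec W p s t s'`: on a machine with word bound `W`, program `p` started in state `s` halts
in state `s'` after exactly `t` units of time, without overflow or division by zero. -/
inductive Exec (W : ℕ) : Prog → State → ℕ → State → Prop where
  | skip (s : State) : Exec W .skip s 1 s
  | iset {s : State} {v : ℕ} {e : IExp} (he : e.Fits W s) :
      Exec W (.iset v e) s (e.cost + 1) (s.setI v (e.eval s))
  | iwrite {s : State} {a : ℕ} {i e : IExp} (hi : i.Fits W s) (he : e.Fits W s) :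
      Exec W (.iwrite a i e) s (i.cost + e.cost + 1) (s.writeI a (i.eval s) (e.eval s))
  | rset {s : State} {v : ℕ} {e : RExp} (he : e.Fits W s) :
      Exec W (.rset v e) s (e.cost + 1) (s.setR v (e.eval s))
  | rwrite {s : State} {a : ℕ} {i : IExp} {e : RExp} (hi : i.Fits W s) (he : e.Fits W s) :
      Exec W (.rwrite a i e) s (i.cost + e.cost + 1) (s.writeR a (i.eval s) (e.eval s))
  | seq {s s₁ s₂ : State} {p q : Prog} {t₁ t₂ : ℕ} (hp : Exec W p s t₁ s₁)
      (hq : Exec W q s₁ t₂ s₂) : Exec W (.seq p q) s (t₁ + t₂) s₂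
  | ite_true {s s₁ : State} {b : Test} {p q : Prog} {t : ℕ} (hf : b.Fits W s) (hb : b.Holds s)
      (hp : Exec W p s t s₁) : Exec W (.ite b p q) s (b.cost + t + 1) s₁
  | ite_false {s s₁ : State} {b : Test} {p q : Prog} {t : ℕ} (hf : b.Fits W s)
      (hb : ¬ b.Holds s) (hq : Exec W q s t s₁) : Exec W (.ite b p q) s (b.cost + t + 1) s₁
  | loop_done {s : State} {b : Test} {p : Prog} (hf : b.Fits W s) (hb : ¬ b.Holds s) :
      Exec W (.loop b p) s (b.cost + 1) s
  | loop_step {s s₁ s₂ : State} {b : Test} {p : Prog} {t₁ t₂ : ℕ} (hf : b.Fits W s)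
      (hb : b.Holds s) (hp : Exec W p s t₁ s₁) (hl : Exec W (.loop b p) s₁ t₂ s₂) :
      Exec W (.loop b p) s (b.cost + t₁ + t₂ + 1) s₂

/-- The initial state: integer variables `0, 1` hold `n` and the number `m` of colors, integer
array `0` the colors of the points, real variables `0, 1, 2, 3` the sides of the rectangle, real
arrays `0` and `1` the `x`- and `y`-coordinates of the points; everything else is `0`. -/
noncomputable def inputState {n m : ℕ} (I : ColoredPoints n m) : State where
  ivar v := match v with
    | 0 => n
    | 1 => m
    | _ => 0
  imem a i := match a with
    | 0 => if h : i < n then (I.color ⟨i, h⟩ : ℕ) else 0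
    | _ => 0
  rvar v := match v with
    | 0 => I.xmin
    | 1 => I.xmax
    | 2 => I.ymin
    | 3 => I.ymax
    | _ => 0
  rmem a i := match a with
    | 0 => if h : i < n then (I.pt ⟨i, h⟩).1 else 0
    | 1 => if h : i < n then (I.pt ⟨i, h⟩).2 else 0
    | _ => 0

/-- The state `s` holds the labeling `L` as output: the number of labels in integer variable `0`,
the labels of the points in integer array `1`, the colors and `y`-coordinates of the labels in
integer array `2` and real array `2`. -/
structure Outputs {n m : ℕ} (s : State) (L : Labeling n m) : Prop where
  numLabels : s.ivar 0 = L.numLabels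
  assign : ∀ i : Fin n, s.imem 1 i = L.assign i
  color : ∀ l : Fin L.numLabels, s.imem 2 l = L.color l
  y : ∀ l : Fin L.numLabels, s.rmem 2 l = L.y l

end Backbone

/-! Scan the points from left to right. Every backbone met so far extends to the right side of the
rectangle, so these backbones cut the remaining part into horizontal strips, and no connector can
cross the border of its strip. The strips are therefore independent subproblems. A strip is
described by the number `k` of points still to come and, for each of its two bordering backbones,
the color and the gap between consecutive point heights in which it lies; exact heights inside a gap
are irrelevant. This gives `(n + 1) * (m + 1)` codes for a border, where the extra color `m` stands
for the bottom or top side, to which no point can be attached.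

In the recursion `dp`, the leftmost remaining point is skipped if it lies outside the strip.
Otherwise it is attached for free to a border of its color, or it opens a backbone in some gap,
which costs one label and splits the strip in two.

Optimality is a pair of inequalities. By `dp_le_card`, every crossing-free labeling has at least
`dp` labels strictly inside a strip: if the label of the leftmost point lies inside, it is a new
label that splits the strip; if not, the connector of a point inside meets a border and hence
belongs to that border. Conversely, `Sweep.run_spec` follows the recorded decisions from left to
right and places each new backbone in the middle of the open interval allowed by its gap and its two
neighbors. This produces exactly `dp` labels in each strip. Nothing crosses, since a connector never
leaves its strip and later backbones start further to the right.

The table has `n * ((n + 1) * (m + 1)) ^ 2` entries to compute, each by a scan over at most `n + 1`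
gaps, which gives the running time; ranking the points by pairwise comparison and the final sweep
are quadratic in `n`. The program is verified by weakest preconditions for loop-free code together
with a rule for loops with a known number of rounds; the invariants identify array contents with
ranks, values of `dp` and states of the sweep. -/

namespace Backbone

/-! ### Program logic with time bounds -/

/-- Started in `s`, program `p` halts within `T` units of time in a state satisfying `Q`. -/
def Runs (W : ℕ) (p : Prog) (s : State) (T : ℕ) (Q : State → Prop) : Prop :=
  ∃ t s', Exec W p s t s' ∧ t ≤ T ∧ Q s'

/-- Worst-case time of a loop-free program. -/
def Prog.time : Prog → ℕ
  | .skip => 1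
  | .iset _ e => e.cost + 1
  | .iwrite _ i e => i.cost + e.cost + 1
  | .rset _ e => e.cost + 1
  | .rwrite _ i e => i.cost + e.cost + 1
  | .seq p q => p.time + q.time
  -- Only an upper bound is needed, so the branches are added. The value for loops never matters,
  -- since their `wp` is `False`.
  | .ite b p q => b.cost + (p.time + q.time) + 1
  | .loop _ _ => 0

/-- Weakest precondition of a loop-free program. -/
def Prog.wp (W : ℕ) : Prog → (State → Prop) → State → Prop
  | .skip, Q, s => Q s
  | .iset v e, Q, s => e.Fits W s ∧ Q (s.setI v (e.eval s))
  | .iwrite a i e, Q, s => i.Fits W s ∧ e.Fits W s ∧ Q (s.writeI a (i.eval s) (e.eval s))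
  | .rset v e, Q, s => e.Fits W s ∧ Q (s.setR v (e.eval s))
  | .rwrite a i e, Q, s => i.Fits W s ∧ e.Fits W s ∧ Q (s.writeR a (i.eval s) (e.eval s))
  | .seq p q, Q, s => p.wp W (q.wp W Q) s
  | .ite b p q, Q, s => b.Fits W s ∧ (b.Holds s → p.wp W Q s) ∧ (¬ b.Holds s → q.wp W Q s)
  | .loop _ _, _, _ => False

theorem Prog.wp.mono {W : ℕ} {p : Prog} {Q Q' : State → Prop} {s : State} (h : p.wp W Q s)
    (hQ : ∀ s', Q s' → Q' s') : p.wp W Q' s := by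
  induction p generalizing s Q Q' with
  | skip => exact hQ _ h
  | iset v e => exact ⟨h.1, hQ _ h.2⟩
  | iwrite a i e => exact ⟨h.1, h.2.1, hQ _ h.2.2⟩
  | rset v e => exact ⟨h.1, hQ _ h.2⟩
  | rwrite a i e => exact ⟨h.1, h.2.1, hQ _ h.2.2⟩
  | seq p q ihp ihq => exact ihp (Q := q.wp W Q) h fun s' h' => ihq h' hQ
  | ite b p q ihp ihq => exact ⟨h.1, fun hb => ihp (h.2.1 hb) hQ, fun hb => ihq (h.2.2 hb) hQ⟩
  | loop b p => exact h.elim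

namespace Runs

variable {W : ℕ} {s : State} {Q : State → Prop}

theorem mono {p : Prog} {T T' : ℕ} {Q' : State → Prop} (h : Runs W p s T Q) (hT : T ≤ T')
    (hQ : ∀ s', Q s' → Q' s') : Runs W p s T' Q' := by
  obtain ⟨t, s', h1, h2, h3⟩ := h
  exact ⟨t, s', h1, h2.trans hT, hQ _ h3⟩

theorem seq {p q : Prog} {T₁ T₂ : ℕ} (h : Runs W p s T₁ fun s' => Runs W q s' T₂ Q) :
    Runs W (.seq p q) s (T₁ + T₂) Q := by
  obtain ⟨t, s₁, h1, h2, t', s₂, h3, h4, h5⟩ := h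
  exact ⟨_, s₂, .seq h1 h3, by omega, h5⟩

theorem of_wp {p : Prog} (h : p.wp W Q s) : Runs W p s p.time Q := by
  induction p generalizing s Q with
  | skip => exact ⟨_, _, .skip s, le_rfl, h⟩
  | iset v e => exact ⟨_, _, .iset h.1, le_rfl, h.2⟩
  | iwrite a i e => exact ⟨_, _, .iwrite h.1 h.2.1, le_rfl, h.2.2⟩
  | rset v e => exact ⟨_, _, .rset h.1, le_rfl, h.2⟩
  | rwrite a i e => exact ⟨_, _, .rwrite h.1 h.2.1, le_rfl, h.2.2⟩
  | seq p q ihp ihq => exact .seq ((ihp h).mono le_rfl fun s' h' => ihq h')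
  | ite b p q ihp ihq =>
    obtain ⟨hf, hp, hq⟩ := h
    by_cases hb : b.Holds s
    · obtain ⟨t, s', h1, h2, h3⟩ := ihp (hp hb)
      exact ⟨_, s', .ite_true hf hb h1, by simp only [Prog.time]; omega, h3⟩
    · obtain ⟨t, s', h1, h2, h3⟩ := ihq (hq hb)
      exact ⟨_, s', .ite_false hf hb h1, by simp only [Prog.time]; omega, h3⟩
  | loop b p => exact h.elim

/-- A loop whose body is executed exactly `N` times, with an invariant that may depend on the
number of rounds. -/
theorem loop {b : Test} {p : Prog} (Inv : ℕ → State → Prop) (N T : ℕ) (h0 : Inv 0 s)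
    (hstep : ∀ j < N, ∀ s, Inv j s →
      b.Fits W s ∧ b.Holds s ∧ Runs W p s T (Inv (j + 1)))
    (hdone : ∀ s, Inv N s → b.Fits W s ∧ ¬ b.Holds s ∧ Q s) :
    Runs W (.loop b p) s (N * (b.cost + T + 1) + (b.cost + 1)) Q := by
  -- Induction on the number `k` of rounds left, because a loop unfolds at its front.
  suffices H : ∀ k j s, j + k = N → Inv j s →
      Runs W (.loop b p) s (k * (b.cost + T + 1) + (b.cost + 1)) Q from H N 0 s (by omega) h0
  intro k
  induction k with
  | zero =>
    intro j s hj hs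
    obtain rfl : j = N := by omega
    obtain ⟨h1, h2, h3⟩ := hdone s hs
    exact ⟨_, s, .loop_done h1 h2, by omega, h3⟩
  | succ k ih =>
    intro j s hj hs
    obtain ⟨h1, h2, t, s₁, h3, h4, h5⟩ := hstep j (by omega) s hs
    obtain ⟨t', s₂, h6, h7, h8⟩ := ih (j + 1) s₁ (by omega) h5
    exact ⟨_, s₂, .loop_step h1 h2 h3 h6, by rw [Nat.succ_mul]; omega, h8⟩

/-- Straight-line code, followed by a loop, followed by straight-line code. -/
theorem seq_loop_seq {p body q : Prog} {b : Test} (Inv : ℕ → State → Prop) (N T : ℕ)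
    (h0 : p.wp W (Inv 0) s)
    (hstep : ∀ j < N, ∀ s, Inv j s →
      b.Fits W s ∧ b.Holds s ∧ Runs W body s T (Inv (j + 1)))
    (hdone : ∀ s, Inv N s → b.Fits W s ∧ ¬ b.Holds s ∧ q.wp W Q s) :
    Runs W (.seq p (.seq (.loop b body) q)) s
      (p.time + (N * (b.cost + T + 1) + (b.cost + 1) + q.time)) Q :=
  .seq ((of_wp h0).mono le_rfl fun _ h => .seq (.loop Inv N T h hstep fun s hs =>
    ⟨(hdone s hs).1, (hdone s hs).2.1, of_wp (hdone s hs).2.2⟩))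

end Runs

/-! ### Reading a state after one update. -/

namespace State

variable (s : State)

theorem setI_ivar (v x w : ℕ) : (s.setI v x).ivar w = if w = v then x else s.ivar w := by
  simp [setI, Function.update_apply]

theorem setI_imem (v x : ℕ) : (s.setI v x).imem = s.imem := rfl

theorem setI_rvar (v x : ℕ) : (s.setI v x).rvar = s.rvar := rfl

theorem setI_rmem (v x : ℕ) : (s.setI v x).rmem = s.rmem := rfl

theorem setR_ivar (v : ℕ) (x : ℝ) : (s.setR v x).ivar = s.ivar := rfl

theorem setR_imem (v : ℕ) (x : ℝ) : (s.setR v x).imem = s.imem := rfl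

theorem setR_rvar (v : ℕ) (x : ℝ) (w : ℕ) :
    (s.setR v x).rvar w = if w = v then x else s.rvar w := by
  simp [setR, Function.update_apply]

theorem setR_rmem (v : ℕ) (x : ℝ) : (s.setR v x).rmem = s.rmem := rfl

theorem writeI_ivar (a i x : ℕ) : (s.writeI a i x).ivar = s.ivar := rfl

theorem writeI_imem (a i x b : ℕ) :
    (s.writeI a i x).imem b = if b = a then Function.update (s.imem a) i x else s.imem b := by
  simp [writeI, Function.update_apply]

theorem writeI_rvar (a i x : ℕ) : (s.writeI a i x).rvar = s.rvar := rfl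

theorem writeI_rmem (a i x : ℕ) : (s.writeI a i x).rmem = s.rmem := rfl

theorem writeR_ivar (a i : ℕ) (x : ℝ) : (s.writeR a i x).ivar = s.ivar := rfl

theorem writeR_imem (a i : ℕ) (x : ℝ) : (s.writeR a i x).imem = s.imem := rfl

theorem writeR_rvar (a i : ℕ) (x : ℝ) : (s.writeR a i x).rvar = s.rvar := rfl

theorem writeR_rmem (a i : ℕ) (x : ℝ) (b : ℕ) :
    (s.writeR a i x).rmem b = if b = a then Function.update (s.rmem a) i x else s.rmem b := by
  simp [writeR, Function.update_apply]

end State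

/-! ### The dynamic program -/

/-- Minimum of `f` on `a, …, a + d` and a point where it is attained. -/
def argScan (f : ℕ → ℕ) (a : ℕ) : ℕ → ℕ × ℕ
  | 0 => (f a, a)
  | d + 1 =>
    if f (a + d + 1) < (argScan f a d).1 then (f (a + d + 1), a + d + 1) else argScan f a d

theorem argScan_spec (f : ℕ → ℕ) (a d : ℕ) :
    (argScan f a d).1 = f (argScan f a d).2 ∧ a ≤ (argScan f a d).2 ∧
      (argScan f a d).2 ≤ a + d := by
  induction d with
  | zero => simp [argScan]
  | succ d ih =>
    rw [argScan]
    split_ifs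
    · exact ⟨rfl, by simp only; omega, by simp only; omega⟩
    · exact ⟨ih.1, ih.2.1, by omega⟩

theorem argScan_le (f : ℕ → ℕ) (a d : ℕ) {g : ℕ} (h1 : a ≤ g) (h2 : g ≤ a + d) :
    (argScan f a d).1 ≤ f g := by
  induction d with
  | zero => obtain rfl : g = a := by omega
            exact le_rfl
  | succ d ih =>
    rw [argScan]
    rcases Nat.lt_or_ge (a + d) g with h | h
    · obtain rfl : g = a + d + 1 := by omega
      split_ifs with h'
      · exact le_rfl
      · omega
    · have := ih h
      split_ifs with h'
      · exact h'.le.trans this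
      · exact this

/-- The number of additional backbones needed for those of the `k` rightmost points that lie
between two backbones `b` and `t`, and the decision for the leftmost of these `k` points: `0` if it
is connected to `b` or `t`, and `g + 1` if it starts a new backbone in the gap `g`.
The point with `k` points to its right has `yr k` points below it and color `ck k`; a backbone of
color `c` with `g` points below it is encoded as `g * M + c`. -/
def dp (M : ℕ) (yr ck : ℕ → ℕ) : ℕ → ℕ → ℕ → ℕ × ℕ
  | 0, _, _ => (0, 0)
  | k + 1, b, t =>
    -- Both extreme gaps are allowed: a new backbone may share the gap of `b` or of `t`, and then
    -- one of the two parts contains no point.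
    let r := argScan (fun g => 1 + (dp M yr ck k b (g * M + ck k)).1 +
      (dp M yr ck k (g * M + ck k) t).1) (b / M) (t / M - b / M)
    if b / M ≤ yr k ∧ yr k < t / M then
      if (ck k = t % M ∨ ck k = b % M) ∧ (dp M yr ck k b t).1 ≤ r.1 then
        ((dp M yr ck k b t).1, 0)
      else (r.1, r.2 + 1)
    else ((dp M yr ck k b t).1, 0)

section dp

variable {M : ℕ} {yr ck : ℕ → ℕ} {k b t : ℕ}

theorem dp_succ_of_not (h : ¬ (b / M ≤ yr k ∧ yr k < t / M)) :
    (dp M yr ck (k + 1) b t).1 = (dp M yr ck k b t).1 := by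
  rw [dp, if_neg h]

theorem dp_succ_le_of_match (h : b / M ≤ yr k ∧ yr k < t / M)
    (hc : ck k = t % M ∨ ck k = b % M) :
    (dp M yr ck (k + 1) b t).1 ≤ (dp M yr ck k b t).1 := by
  rw [dp, if_pos h]
  split_ifs with h'
  · exact le_rfl
  · exact (lt_of_not_ge fun h'' => h' ⟨hc, h''⟩).le

theorem dp_succ_le_of_split (h : b / M ≤ yr k ∧ yr k < t / M) {g : ℕ} (h1 : b / M ≤ g)
    (h2 : g ≤ t / M) :
    (dp M yr ck (k + 1) b t).1 ≤
      1 + (dp M yr ck k b (g * M + ck k)).1 + (dp M yr ck k (g * M + ck k) t).1 := by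
  have := argScan_le (fun g => 1 + (dp M yr ck k b (g * M + ck k)).1 +
      (dp M yr ck k (g * M + ck k) t).1) (b / M) (t / M - b / M) h1 (by omega)
  rw [dp, if_pos h]
  split_ifs with h'
  · exact h'.2.trans this
  · exact this

/-- The exact value along the recorded decision, which the construction of a labeling follows. The
lower bound on labelings needs only the inequalities above. -/
theorem dp_succ_spec (h : b / M ≤ yr k ∧ yr k < t / M) :
    ((dp M yr ck (k + 1) b t).2 = 0 ∧ (ck k = t % M ∨ ck k = b % M) ∧
      (dp M yr ck (k + 1) b t).1 = (dp M yr ck k b t).1) ∨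
    ∃ g, (dp M yr ck (k + 1) b t).2 = g + 1 ∧ b / M ≤ g ∧ g ≤ t / M ∧
      (dp M yr ck (k + 1) b t).1 =
        1 + (dp M yr ck k b (g * M + ck k)).1 + (dp M yr ck k (g * M + ck k) t).1 := by
  have := argScan_spec (fun g => 1 + (dp M yr ck k b (g * M + ck k)).1 +
      (dp M yr ck k (g * M + ck k) t).1) (b / M) (t / M - b / M)
  rw [dp, if_pos h]
  split_ifs with h'
  · exact .inl ⟨rfl, h'.1, rfl⟩
  · exact .inr ⟨_, rfl, this.2.1, by omega, this.1⟩

/-- No point height separates the two borders, so every point is skipped. -/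
theorem dp_eq_zero (h : t / M ≤ b / M) : (dp M yr ck k b t).1 = 0 := by
  induction k with
  | zero => rfl
  | succ k ih => rw [dp_succ_of_not (by omega), ih]

theorem code_div {M g c : ℕ} (hc : c < M) : (g * M + c) / M = g := by
  rw [mul_comm, Nat.mul_add_div (by omega), Nat.div_eq_of_lt hc, add_zero]

theorem code_mod {M g c : ℕ} (hc : c < M) : (g * M + c) % M = c := by
  rw [mul_comm, Nat.mul_add_mod, Nat.mod_eq_of_lt hc]

/-- One new backbone per point suffices: put it into the gap of `b`, so that the lower part is
empty. This keeps table values below the word bound. -/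
theorem dp_le (hc : ∀ j < k, ck j < M) : (dp M yr ck k b t).1 ≤ k := by
  induction k generalizing b t with
  | zero => exact le_rfl
  | succ k ih =>
    by_cases h : b / M ≤ yr k ∧ yr k < t / M
    · have h1 := dp_succ_le_of_split (ck := ck) h le_rfl (by omega)
      have h2 : (dp M yr ck k b (b / M * M + ck k)).1 = 0 :=
        dp_eq_zero (code_div (hc k (by omega))).le
      have h3 := ih (b := b / M * M + ck k) (t := t) fun j hj => hc j (by omega)
      omega
    · rw [dp_succ_of_not h]
      exact (ih fun j hj => hc j (by omega)).trans (by omega)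

/-- Keeps the stored decisions below the word bound, and the gaps read from them among the `n + 1`
existing ones. -/
theorem dp_choice_le : (dp M yr ck k b t).2 ≤ t / M + 1 := by
  cases k with
  | zero => simp [dp]
  | succ k =>
    by_cases h : b / M ≤ yr k ∧ yr k < t / M
    · rcases dp_succ_spec (ck := ck) h with h | ⟨g, h⟩ <;> omega
    · rw [dp, if_neg h]
      simp

end dp

/-! ### Points in sorted order -/

namespace ColoredPoints

variable {n m : ℕ} (I : ColoredPoints n m)

noncomputable def px (i : ℕ) : ℝ := if h : i < n then (I.pt ⟨i, h⟩).1 else 0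

noncomputable def py (i : ℕ) : ℝ := if h : i < n then (I.pt ⟨i, h⟩).2 else 0

def pc (i : ℕ) : ℕ := if h : i < n then (I.color ⟨i, h⟩ : ℕ) else 0

variable {I}

theorem px_val (i : Fin n) : I.px i = (I.pt i).1 := by simp [px]

theorem py_val (i : Fin n) : I.py i = (I.pt i).2 := by simp [py]

theorem pc_val (i : Fin n) : I.pc i = I.color i := by simp [pc]

theorem py_mem {i : ℕ} (hi : i < n) : I.ymin < I.py i ∧ I.py i < I.ymax := by
  have := (I.pt_mem ⟨i, hi⟩).2
  simp only [py, hi, dif_pos]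
  exact this

theorem pc_lt {i : ℕ} (hi : i < n) : I.pc i < m := by
  simp [pc, hi]

theorem px_inj {i j : ℕ} (hi : i < n) (hj : j < n) (h : I.px i = I.px j) : i = j := by
  simp only [px, hi, hj, dif_pos] at h
  simpa using I.x_injective h

theorem py_inj {i j : ℕ} (hi : i < n) (hj : j < n) (h : I.py i = I.py j) : i = j := by
  simp only [py, hi, hj, dif_pos] at h
  simpa using I.y_injective h

/-! ### Ranks of the points by their coordinates. -/

variable (I) in
/-- The number of points to the right of point `i`. -/
noncomputable def rx (i : ℕ) : ℕ := ((Finset.range n).filter fun j => I.px i < I.px j).card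

variable (I) in
/-- The number of points below point `i`. -/
noncomputable def ry (i : ℕ) : ℕ := ((Finset.range n).filter fun j => I.py j < I.py i).card

theorem rx_lt_rx {i j : ℕ} (hj : j < n) (h : I.px i < I.px j) : I.rx j < I.rx i := by
  refine Finset.card_lt_card (Finset.ssubset_iff_of_subset ?_ |>.2 ⟨j, by simp [hj, h], by simp⟩)
  intro a
  simp only [Finset.mem_filter]
  exact fun ha => ⟨ha.1, h.trans ha.2⟩

theorem ry_lt_ry {i j : ℕ} (hj : j < n) (h : I.py j < I.py i) : I.ry j < I.ry i := by
  refine Finset.card_lt_card (Finset.ssubset_iff_of_subset ?_ |>.2 ⟨j, by simp [hj, h], by simp⟩)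
  intro a
  simp only [Finset.mem_filter]
  exact fun ha => ⟨ha.1, ha.2.trans h⟩

theorem rx_lt {i : ℕ} (hi : i < n) : I.rx i < n := by
  conv_rhs => rw [← Finset.card_range n]
  exact Finset.card_lt_card (Finset.filter_ssubset.2 ⟨i, by simp [hi]⟩)

theorem ry_lt {i : ℕ} (hi : i < n) : I.ry i < n := by
  conv_rhs => rw [← Finset.card_range n]
  exact Finset.card_lt_card (Finset.filter_ssubset.2 ⟨i, by simp [hi]⟩)

theorem rx_inj {i j : ℕ} (hi : i < n) (hj : j < n) (h : I.rx i = I.rx j) : i = j := by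
  rcases lt_trichotomy (I.px i) (I.px j) with h' | h' | h'
  · have := rx_lt_rx hj h'
    omega
  · exact px_inj hi hj h'
  · have := rx_lt_rx hi h'
    omega

theorem ry_inj {i j : ℕ} (hi : i < n) (hj : j < n) (h : I.ry i = I.ry j) : i = j := by
  rcases lt_trichotomy (I.py i) (I.py j) with h' | h' | h'
  · have := ry_lt_ry hi h'
    omega
  · exact py_inj hi hj h'
  · have := ry_lt_ry hj h'
    omega

/-- Pigeonhole; it is what makes every rank occur. -/
theorem exists_of_inj {f : ℕ → ℕ} (hf : ∀ i < n, f i < n)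
    (hinj : ∀ i < n, ∀ j < n, f i = f j → i = j) {r : ℕ} (hr : r < n) : ∃ i < n, f i = r := by
  have := Finset.surjOn_of_injOn_of_card_le (s := Finset.range n) (t := Finset.range n) f
    (fun i hi => by simpa using hf i (by simpa using hi))
    (fun i hi j hj h => hinj i (by simpa using hi) j (by simpa using hj) h) le_rfl
  obtain ⟨i, hi, rfl⟩ := this (show r ∈ (Finset.range n : Set ℕ) by simpa using hr)
  exact ⟨i, by simpa using hi, rfl⟩

theorem exists_rx {k : ℕ} (hk : k < n) : ∃ i < n, I.rx i = k :=
  exists_of_inj (fun _ => rx_lt) (fun _ hi _ hj => rx_inj hi hj) hk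

theorem ymin_lt_ymax {k : ℕ} (hk : k < n) : I.ymin < I.ymax :=
  (py_mem hk).1.trans (py_mem hk).2

end ColoredPoints

open ColoredPoints

/-- The points in sorted order: `ord k` is the point with `k` points to its right, `yr k` the
number of points below it and `ck k` its color; `S` lists the `y`-coordinates of the points, with
those of the bottom and the top side of the rectangle. -/
structure IsSorted {n m : ℕ} (I : ColoredPoints n m) (ord yr ck : ℕ → ℕ) (S : ℕ → ℝ) : Prop where
  ord_rx : ∀ i < n, ord (I.rx i) = i
  yr_rx : ∀ i < n, yr (I.rx i) = I.ry i
  ck_rx : ∀ i < n, ck (I.rx i) = I.pc i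
  -- The shift by one makes room for the bottom side at index `0`, so that gap `g` is the interval
  -- between `S g` and `S (g + 1)`.
  S_ry : ∀ i < n, S (I.ry i + 1) = I.py i
  S_zero : S 0 = I.ymin
  S_last : S (n + 1) = I.ymax

namespace IsSorted

variable {n m : ℕ} {I : ColoredPoints n m} {ord yr ck : ℕ → ℕ} {S : ℕ → ℝ}
  (hS : IsSorted I ord yr ck S)

include hS

theorem ord_lt {k : ℕ} (hk : k < n) : ord k < n := by
  obtain ⟨i, hi, rfl⟩ := exists_rx (I := I) hk
  rwa [hS.ord_rx i hi]

theorem rx_ord {k : ℕ} (hk : k < n) : I.rx (ord k) = k := by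
  obtain ⟨i, hi, rfl⟩ := exists_rx (I := I) hk
  rw [hS.ord_rx i hi]

theorem ord_inj {j k : ℕ} (hj : j < n) (hk : k < n) (h : ord j = ord k) : j = k := by
  rw [← hS.rx_ord hj, ← hS.rx_ord hk, h]

theorem px_lt {j k : ℕ} (hjk : j < k) (hk : k < n) : I.px (ord k) < I.px (ord j) := by
  rcases lt_trichotomy (I.px (ord k)) (I.px (ord j)) with h | h | h
  · exact h
  · have := hS.ord_inj hk (hjk.trans hk) (px_inj (hS.ord_lt hk) (hS.ord_lt (hjk.trans hk)) h)
    omega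
  · have := rx_lt_rx (hS.ord_lt hk) h
    rw [hS.rx_ord hk, hS.rx_ord (hjk.trans hk)] at this
    omega

theorem yr_eq {k : ℕ} (hk : k < n) : yr k = I.ry (ord k) := by
  obtain ⟨i, hi, rfl⟩ := exists_rx (I := I) hk
  rw [hS.yr_rx i hi, hS.ord_rx i hi]

theorem yr_lt {k : ℕ} (hk : k < n) : yr k < n := by
  rw [hS.yr_eq hk]
  exact ry_lt (hS.ord_lt hk)

theorem ck_eq {k : ℕ} (hk : k < n) : ck k = I.pc (ord k) := by
  obtain ⟨i, hi, rfl⟩ := exists_rx (I := I) hk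
  rw [hS.ck_rx i hi, hS.ord_rx i hi]

theorem ck_lt {k : ℕ} (hk : k < n) : ck k < m := by
  rw [hS.ck_eq hk]
  exact pc_lt (hS.ord_lt hk)

theorem S_yr {k : ℕ} (hk : k < n) : S (yr k + 1) = I.py (ord k) := by
  rw [hS.yr_eq hk, hS.S_ry _ (hS.ord_lt hk)]

/-- Each index strictly between `0` and `n + 1` belongs to a point, and points lie strictly between
the sides. Without points the rectangle may be degenerate, whence `0 < n`. -/
theorem S_lt {g g' : ℕ} (hn : 0 < n) (hg : g < g') (hg' : g' ≤ n + 1) : S g < S g' := by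
  have key : ∀ r, 1 ≤ r → r ≤ n → ∃ i < n, I.ry i + 1 = r := fun r h1 h2 => by
    obtain ⟨i, hi, h⟩ := exists_of_inj (fun _ => ry_lt (I := I))
      (fun _ hi _ hj => ry_inj hi hj) (show r - 1 < n by omega)
    exact ⟨i, hi, by omega⟩
  rcases Nat.eq_zero_or_pos g with rfl | h0
  · rw [hS.S_zero]
    rcases Nat.lt_or_ge n g' with h | h
    · obtain rfl : g' = n + 1 := by omega
      rw [hS.S_last]
      exact ymin_lt_ymax (I := I) hn
    · obtain ⟨i, hi, rfl⟩ := key g' (by omega) h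
      rw [hS.S_ry i hi]
      exact (py_mem hi).1
  · obtain ⟨i, hi, rfl⟩ := key g h0 (by omega)
    rw [hS.S_ry i hi]
    rcases Nat.lt_or_ge n g' with h | h
    · obtain rfl : g' = n + 1 := by omega
      rw [hS.S_last]
      exact (py_mem hi).2
    · obtain ⟨j, hj, rfl⟩ := key g' (by omega) h
      rw [hS.S_ry j hj]
      by_contra hij
      rcases (not_lt.1 hij).lt_or_eq with h' | h'
      · have := ry_lt_ry hj h'
        omega
      · rw [py_inj hj hi h'] at hg
        omega

theorem S_le {g g' : ℕ} (hn : 0 < n) (hg : g ≤ g') (hg' : g' ≤ n + 1) : S g ≤ S g' := by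
  rcases hg.eq_or_lt with rfl | h
  · exact le_rfl
  · exact (hS.S_lt hn h hg').le

end IsSorted

/-! ### The lower bound -/

section LowerBound

variable {n m : ℕ} {I : ColoredPoints n m} {ord yr ck : ℕ → ℕ} {S : ℕ → ℝ} {L : Labeling n m}

variable (I) in
/-- The number of points at or below height `h`. -/
noncomputable def gapOf (h : ℝ) : ℕ := ((Finset.range n).filter fun j => I.py j ≤ h).card

/-- An arbitrary labeling may have a backbone exactly at the height of a point. Such a point counts
as lying below the backbone, which turns the comparison of integers made by `dp` into a strict
inequality of heights. -/
theorem gapOf_le_yr_iff (hS : IsSorted I ord yr ck S) {k : ℕ} (hk : k < n) (h : ℝ) :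
    gapOf I h ≤ yr k ↔ h < I.py (ord k) := by
  rw [hS.yr_eq hk]
  constructor
  · intro hle
    by_contra hlt
    refine hle.not_gt (Finset.card_lt_card (Finset.ssubset_iff_of_subset ?_ |>.2
      ⟨ord k, by simp [hS.ord_lt hk, not_lt.1 hlt], by simp⟩))
    intro a
    simp only [Finset.mem_filter]
    exact fun ha => ⟨ha.1, ha.2.le.trans (not_lt.1 hlt)⟩
  · intro hlt
    refine Finset.card_le_card fun a => ?_
    simp only [Finset.mem_filter]
    exact fun ha => ⟨ha.1, ha.2.trans_lt hlt⟩

theorem gapOf_mono {h h' : ℝ} (hh : h ≤ h') : gapOf I h ≤ gapOf I h' := by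
  refine Finset.card_le_card fun a => ?_
  simp only [Finset.mem_filter]
  exact fun ha => ⟨ha.1, ha.2.trans hh⟩

/-- Some point with at least `k` points to its right is assigned to label `l`. -/
def IsActive (ord : ℕ → ℕ) (L : Labeling n m) (k : ℕ) (l : Fin L.numLabels) : Prop :=
  ∃ j, k ≤ j ∧ ∃ h : ord j < n, j < n ∧ L.assign ⟨ord j, h⟩ = l

theorem IsActive.mono {k k' : ℕ} {l : Fin L.numLabels} (h : IsActive ord L k l) (hk : k' ≤ k) :
    IsActive ord L k' l := by
  obtain ⟨j, h1, h2⟩ := h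
  exact ⟨j, hk.trans h1, h2⟩

theorem IsActive.of_pred (hS : IsSorted I ord yr ck S) {k : ℕ} (hk : k < n)
    {l : Fin L.numLabels} (h : IsActive ord L k l) :
    IsActive ord L (k + 1) l ∨ l = L.assign ⟨ord k, hS.ord_lt hk⟩ := by
  obtain ⟨j, h1, h2, h3, h4⟩ := h
  rcases h1.eq_or_lt with rfl | h1
  · exact .inr h4.symm
  · exact .inl ⟨j, h1, h2, h3, h4⟩

/-- The backbone of `l` starts at a point further left and so passes the abscissa of point `ord k`.
If its height were in the range of the connector, the two leaders would share a point. -/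
theorem IsActive.notMem_uIcc (hS : IsSorted I ord yr ck S) (hL : I.IsCrossingFree L) {k : ℕ}
    (hk : k < n) {l : Fin L.numLabels} (h : IsActive ord L (k + 1) l)
    (hl : l ≠ L.assign ⟨ord k, hS.ord_lt hk⟩) :
    L.y l ∉ Set.uIcc (I.py (ord k)) (L.y (L.assign ⟨ord k, hS.ord_lt hk⟩)) := by
  intro hmem
  obtain ⟨j, h1, h2, h3, h4⟩ := h
  have hx := hS.px_lt (show k < j by omega) h3
  refine Set.disjoint_left.1 (hL.disjoint l _ hl)
    (show (I.px (ord k), L.y l) ∈ I.leader L l from .inl ?_) (.inr ?_)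
  · refine ⟨rfl, ?_, ⟨ord j, h2⟩, h4, ?_⟩
    · have := (I.pt_mem ⟨ord k, hS.ord_lt hk⟩).1.2
      rw [← px_val] at this
      exact this.le
    · rw [← px_val]
      exact hx.le
  · simp only [Set.mem_iUnion, Set.mem_ofPred_eq, exists_prop]
    refine ⟨⟨ord k, hS.ord_lt hk⟩, rfl, ?_, ?_⟩
    · rw [← px_val]
    · rw [← py_val]
      exact hmem

/-- A crossing-free labeling has at least `dp` labels between two consecutive backbones. -/
theorem dp_le_card (hS : IsSorted I ord yr ck S) (hL : I.IsCrossingFree L) {k : ℕ} (hk : k ≤ n)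
    {b t : ℝ} {cb ct : ℕ} (hcb : cb ≤ m) (hct : ct ≤ m) (hbt : b < t)
    (hb : b < I.ymin ∨ ∃ l, IsActive ord L k l ∧ L.y l = b ∧ (L.color l : ℕ) = cb)
    (ht : I.ymax < t ∨ ∃ l, IsActive ord L k l ∧ L.y l = t ∧ (L.color l : ℕ) = ct)
    (hadj : ∀ l, IsActive ord L k l → ¬ (b < L.y l ∧ L.y l < t)) :
    (dp (m + 1) yr ck k (gapOf I b * (m + 1) + cb) (gapOf I t * (m + 1) + ct)).1 ≤
      (Finset.univ.filter fun l => b < L.y l ∧ L.y l < t).card := by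
  induction k generalizing b t cb ct with
  | zero => exact Nat.zero_le _
  | succ k ih =>
    have hk' : k < n := hk
    have hb' : b < I.ymin ∨ ∃ l, IsActive ord L k l ∧ L.y l = b ∧ (L.color l : ℕ) = cb :=
      hb.imp_right fun ⟨l, h, h'⟩ => ⟨l, h.mono (by omega), h'⟩
    have ht' : I.ymax < t ∨ ∃ l, IsActive ord L k l ∧ L.y l = t ∧ (L.color l : ℕ) = ct :=
      ht.imp_right fun ⟨l, h, h'⟩ => ⟨l, h.mono (by omega), h'⟩
    set l := L.assign ⟨ord k, hS.ord_lt hk'⟩ with hl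
    set y := I.py (ord k) with hy
    have hlact : IsActive ord L k l := ⟨k, le_rfl, hS.ord_lt hk', hk', rfl⟩
    have hcol : (L.color l : ℕ) = ck k := by
      rw [hL.color_eq, ← pc_val, hS.ck_eq hk']
    have hckm := hS.ck_lt hk'
    have hymem := py_mem (I := I) (hS.ord_lt hk')
    have hlmem := hL.y_mem l
    -- the connector does not pass the neighboring backbones
    have hbn : b ∈ Set.uIcc y (L.y l) → (L.color l : ℕ) = cb ∧ L.y l = b := by
      intro hmem
      rcases hb with hb | ⟨l', h1, h2, h3⟩
      · rw [Set.mem_uIcc] at hmem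
        rcases hmem with h | h <;> linarith [hymem.1, hlmem.1]
      · by_cases hll : l' = l
        · rw [← hll]
          exact ⟨h3, h2⟩
        · exact absurd (h2 ▸ hmem) (h1.notMem_uIcc hS hL hk' hll)
    have htn : t ∈ Set.uIcc y (L.y l) → (L.color l : ℕ) = ct ∧ L.y l = t := by
      intro hmem
      rcases ht with ht | ⟨l', h1, h2, h3⟩
      · rw [Set.mem_uIcc] at hmem
        rcases hmem with h | h <;> linarith [hymem.2, hlmem.2]
      · by_cases hll : l' = l
        · rw [← hll]
          exact ⟨h3, h2⟩
        · exact absurd (h2 ▸ hmem) (h1.notMem_uIcc hS hL hk' hll)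
    have hadj' : ¬ (b < L.y l ∧ L.y l < t) →
        ∀ l', IsActive ord L k l' → ¬ (b < L.y l' ∧ L.y l' < t) := by
      intro h l' hl'
      rcases hl'.of_pred hS hk' with h' | h'
      · exact hadj l' h'
      · rw [h']
        exact h
    have hgb := gapOf_le_yr_iff hS hk' b
    have hgt : yr k < gapOf I t ↔ I.py (ord k) ≤ t := by
      rw [← not_le, gapOf_le_yr_iff hS hk' t, not_lt]
    have db : (gapOf I b * (m + 1) + cb) / (m + 1) = gapOf I b := code_div (by omega)
    have dt : (gapOf I t * (m + 1) + ct) / (m + 1) = gapOf I t := code_div (by omega)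
    by_cases hreg : b < y ∧ y ≤ t
    · have hreg' : (gapOf I b * (m + 1) + cb) / (m + 1) ≤ yr k ∧
          yr k < (gapOf I t * (m + 1) + ct) / (m + 1) := by
        rw [db, dt, hgb, hgt]
        exact hreg
      by_cases hin : b < L.y l ∧ L.y l < t
      · have h1 := ih hk'.le hcb (ct := ck k) (by omega) hin.1 hb' (.inr ⟨l, hlact, rfl, hcol⟩) ?_
        · have h2 := ih hk'.le (cb := ck k) (by omega) hct hin.2 (.inr ⟨l, hlact, rfl, hcol⟩) ht' ?_
          · refine (dp_succ_le_of_split hreg' (g := gapOf I (L.y l)) ?_ ?_).trans ?_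
            · rw [db]
              exact gapOf_mono hin.1.le
            · rw [dt]
              exact gapOf_mono hin.2.le
            · have hsub : insert l ((Finset.univ.filter fun l' => b < L.y l' ∧ L.y l' < L.y l) ∪
                  Finset.univ.filter fun l' => L.y l < L.y l' ∧ L.y l' < t) ⊆
                  Finset.univ.filter fun l => b < L.y l ∧ L.y l < t := by
                intro a
                simp only [Finset.mem_insert, Finset.mem_union, Finset.mem_filter,
                  Finset.mem_univ, true_and]
                rintro (rfl | h | h)
                · exact hin
                · exact ⟨h.1, h.2.trans hin.2⟩
                · exact ⟨hin.1.trans h.1, h.2⟩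
              have hcard := Finset.card_le_card hsub
              rw [Finset.card_insert_of_notMem (by simp), Finset.card_union_of_disjoint] at hcard
              · omega
              · rw [Finset.disjoint_filter]
                intro a _ h h'
                linarith [h.2, h'.1]
          · intro l' hl' hmem
            rcases hl'.of_pred hS hk' with h' | h'
            · exact hadj l' h' ⟨hin.1.trans hmem.1, hmem.2⟩
            · rw [h'] at hmem
              exact lt_irrefl _ hmem.1
        · intro l' hl' hmem
          rcases hl'.of_pred hS hk' with h' | h'
          · exact hadj l' h' ⟨hmem.1, hmem.2.trans hin.2⟩
          · rw [h'] at hmem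
            exact lt_irrefl _ hmem.2
      -- The point is inside the strip and its label is not, so the connector meets `b` or `t`; the
      -- label must then be that border and has its color.
      · refine (dp_succ_le_of_match hreg' ?_).trans
          (ih hk'.le hcb hct hbt hb' ht' (hadj' hin))
        rw [code_mod (by omega), code_mod (by omega), ← hcol]
        rcases le_or_gt (L.y l) b with h | h
        · exact .inr (hbn (Set.mem_uIcc.2 (.inr ⟨h, hreg.1.le⟩))).1
        · refine .inl (htn (Set.mem_uIcc.2 (.inl ⟨hreg.2, ?_⟩))).1
          by_contra h'
          exact hin ⟨h, not_le.1 h'⟩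
    -- The point is outside the strip. Its label cannot be strictly inside, since the connector
    -- would have to pass a border; the strip stays the same.
    · rw [dp_succ_of_not]
      · refine ih hk'.le hcb hct hbt hb' ht' (hadj' fun hin => hreg ?_)
        constructor
        · by_contra h
          exact hin.1.ne' (hbn (Set.mem_uIcc.2 (.inl ⟨not_lt.1 h, hin.1.le⟩))).2
        · by_contra h
          exact hin.2.ne (htn (Set.mem_uIcc.2 (.inr ⟨hin.2.le, (not_le.1 h).le⟩))).2
      · rw [db, dt, hgb, hgt]
        exact hreg

theorem dp_le_numLabels (hS : IsSorted I ord yr ck S) (hL : I.IsCrossingFree L) :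
    (dp (m + 1) yr ck n m (n * (m + 1) + m)).1 ≤ L.numLabels := by
  rcases Nat.eq_zero_or_pos n with rfl | hn
  · exact Nat.zero_le _
  have hlt := ymin_lt_ymax (I := I) hn
  -- Labels may lie on the bottom or top side, so the artificial borders are moved strictly outside
  -- the rectangle.
  have h := dp_le_card hS hL le_rfl (b := I.ymin - 1) (t := I.ymax + 1) (cb := m) (ct := m)
    le_rfl le_rfl (by linarith) (.inl (by linarith)) (.inl (by linarith)) ?_
  · have h0 : gapOf I (I.ymin - 1) = 0 := by
      rw [gapOf, Finset.card_eq_zero, Finset.filter_eq_empty_iff]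
      intro j hj
      have := (py_mem (I := I) (Finset.mem_range.1 hj)).1
      linarith
    have h1 : gapOf I (I.ymax + 1) = n := by
      rw [gapOf, Finset.filter_true_of_mem, Finset.card_range]
      intro j hj
      have := (py_mem (I := I) (Finset.mem_range.1 hj)).2
      linarith
    rw [h0, h1, Nat.zero_mul, Nat.zero_add] at h
    refine h.trans ((Finset.card_filter_le _ _).trans ?_)
    simp
  · rintro l ⟨j, h1, h2, h3, h4⟩
    omega

end LowerBound

/-! ### The sweep that constructs a labeling -/

/-- Among the first `cnt` entries of `height` on the side of `y` given by `r` (below for `<`, above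
for `>`), and `h₀`, the one closest to `y`, with its code and its index. -/
noncomputable def nearest (r : ℝ → ℝ → Prop) (height : ℕ → ℝ) (code : ℕ → ℕ) (y h₀ : ℝ) (c₀ : ℕ) :
    ℕ → ℝ × ℕ × ℕ
  | 0 => (h₀, c₀, 0)
  | l + 1 =>
    open Classical in
    if r (height l) y ∧ r (nearest r height code y h₀ c₀ l).1 (height l) then
      (height l, code l, l)
    else nearest r height code y h₀ c₀ l

/-- One statement serves both directions, with `<` for the neighbor below and `>` for the neighbor
above. The returned index means something only if a label, and not the default, is nearest. -/
theorem nearest_spec (r : ℝ → ℝ → Prop) (hr : ∀ x y z, r x y → r y z → r x z)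
    (height : ℕ → ℝ) (code : ℕ → ℕ) (y h₀ : ℝ) (c₀ : ℕ) (h0 : r h₀ y) (hirr : ∀ x, ¬ r x x)
    (cnt : ℕ) :
    let q := nearest r height code y h₀ c₀ cnt
    ((q.1 = h₀ ∧ q.2.1 = c₀) ∨ q.2.2 < cnt ∧ q.1 = height q.2.2 ∧ q.2.1 = code q.2.2) ∧ r q.1 y ∧
      ∀ l < cnt, r (height l) y → ¬ r q.1 (height l) := by
  induction cnt with
  | zero => simpa [nearest] using h0
  | succ l ih =>
    simp only [nearest]
    split_ifs with h
    · refine ⟨.inr ⟨by simp, rfl, rfl⟩, h.1, fun l' hl' h1 h2 => ?_⟩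
      rcases Nat.lt_succ_iff_lt_or_eq.1 hl' with h' | rfl
      · exact ih.2.2 l' h' h1 (hr _ _ _ h.2 h2)
      · exact hirr _ h2
    · refine ⟨ih.1.imp_right fun h => ⟨by omega, h.2⟩, ih.2.1, fun l' hl' h1 h2 => ?_⟩
      rcases Nat.lt_succ_iff_lt_or_eq.1 hl' with h' | rfl
      · exact ih.2.2 l' h' h1 h2
      · exact h ⟨h1, h2⟩

/-- The labels constructed so far and the assignment of the points seen so far. -/
structure Sweep where
  cnt : ℕ
  height : ℕ → ℝ
  code : ℕ → ℕ
  color : ℕ → ℕ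
  assign : ℕ → ℕ

namespace Sweep

variable {n m : ℕ} (I : ColoredPoints n m) (ord yr ck : ℕ → ℕ) (S : ℕ → ℝ)

def init : Sweep := ⟨0, fun _ => 0, fun _ => 0, fun _ => 0, fun _ => 0⟩

/-- The backbone below point `ord k`: height, code, index. -/
noncomputable def lower (k : ℕ) (st : Sweep) : ℝ × ℕ × ℕ :=
  nearest (· < ·) st.height st.code (I.py (ord k)) I.ymin m st.cnt

/-- The backbone above point `ord k`: height, code, index. -/
noncomputable def upper (k : ℕ) (st : Sweep) : ℝ × ℕ × ℕ :=
  nearest (· > ·) st.height st.code (I.py (ord k)) I.ymax (n * (m + 1) + m) st.cnt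

def connect (st : Sweep) (p l : ℕ) : Sweep :=
  { st with assign := Function.update st.assign p l }

noncomputable def addLabel (st : Sweep) (p : ℕ) (h : ℝ) (code c : ℕ) : Sweep where
  cnt := st.cnt + 1
  height := Function.update st.height st.cnt h
  code := Function.update st.code st.cnt code
  color := Function.update st.color st.cnt c
  assign := Function.update st.assign p st.cnt

/-- Process the point with `k` points to its right. -/
noncomputable def step (k : ℕ) (st : Sweep) : Sweep :=
  let lo := lower I ord k st
  let hi := upper I ord k st
  let ch := (dp (m + 1) yr ck (k + 1) lo.2.1 hi.2.1).2
  if ch = 0 then st.connect (ord k) (if ck k = hi.2.1 % (m + 1) then hi.2.2 else lo.2.2)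
  else st.addLabel (ord k) ((max lo.1 (S (ch - 1)) + min hi.1 (S (ch - 1 + 1))) / 2)
    ((ch - 1) * (m + 1) + ck k) (ck k)

/-- Process the `k` rightmost points, from left to right. -/
noncomputable def run : ℕ → Sweep → Sweep
  | 0, st => st
  | k + 1, st => run k (step I ord yr ck S k st)

/-- Invariant of the sweep when the `k` rightmost points are still to be processed. -/
structure Valid (k : ℕ) (st : Sweep) : Prop where
  cnt_le : st.cnt + k ≤ n
  label : ∀ l < st.cnt, ∃ g ≤ n, st.code l = g * (m + 1) + st.color l ∧ st.color l < m ∧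
    S g < st.height l ∧ st.height l < S (g + 1)
  inj : ∀ l < st.cnt, ∀ l' < st.cnt, st.height l = st.height l' → l = l'
  assign : ∀ j, k ≤ j → j < n →
    st.assign (ord j) < st.cnt ∧ st.color (st.assign (ord j)) = ck j
  -- A backbone whose height is in the range of a foreign connector must start to the right of it;
  -- since ranks count from the right, this reads `j' < j`.
  noncrossing : ∀ j, k ≤ j → j < n → ∀ l < st.cnt, l ≠ st.assign (ord j) →
    st.height l ∈ Set.uIcc (I.py (ord j)) (st.height (st.assign (ord j))) →
    ∀ j', k ≤ j' → j' < n → st.assign (ord j') = l → j' < j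

/-- The bottom side of the rectangle or a backbone. -/
def IsLow (st : Sweep) (h : ℝ) (c : ℕ) : Prop :=
  (h = I.ymin ∧ c = m) ∨ ∃ l < st.cnt, h = st.height l ∧ c = st.code l

/-- The top side of the rectangle or a backbone. -/
def IsHigh (st : Sweep) (h : ℝ) (c : ℕ) : Prop :=
  (h = I.ymax ∧ c = n * (m + 1) + m) ∨ ∃ l < st.cnt, h = st.height l ∧ c = st.code l

/-- A strip of the sweep. Heights and codes are both recorded: several backbones can share a gap and
a color, so heights identify the strip, while the table is indexed by codes. -/
structure Adjacent (st : Sweep) (h : ℝ) (c : ℕ) (h' : ℝ) (c' : ℕ) : Prop where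
  low : st.IsLow I h c
  high : st.IsHigh I h' c'
  lt : h < h'
  empty : ∀ l < st.cnt, ¬ (h < st.height l ∧ st.height l < h')

variable {I ord yr ck S} {st : Sweep} {k : ℕ}

theorem Valid.init : Valid I ord ck S n Sweep.init where
  cnt_le := by simp [Sweep.init]
  label l hl := by simp [Sweep.init] at hl
  inj l hl := by simp [Sweep.init] at hl
  assign j h1 h2 := by omega
  noncrossing j h1 h2 := by omega

/-! ### Strips and the neighbors of a point. -/

section

variable (hS : IsSorted I ord yr ck S) (hst : Valid I ord ck S k st)

include hS hst

theorem IsLow.mem (hn : 0 < n) {h : ℝ} {c : ℕ} (hh : st.IsLow I h c) :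
    S (c / (m + 1)) ≤ h ∧ h < S (c / (m + 1) + 1) ∧ c / (m + 1) ≤ n := by
  rcases hh with ⟨rfl, rfl⟩ | ⟨l, hl, rfl, rfl⟩
  · rw [Nat.div_eq_of_lt (by omega), ← hS.S_zero]
    exact ⟨le_rfl, hS.S_lt hn (by omega) (by omega), by omega⟩
  · obtain ⟨g, h1, h2, h3, h4, h5⟩ := hst.label l hl
    rw [h2, code_div (by omega)]
    exact ⟨h4.le, h5, h1⟩

theorem IsHigh.mem (hn : 0 < n) {h : ℝ} {c : ℕ} (hh : st.IsHigh I h c) :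
    S (c / (m + 1)) < h ∧ h ≤ S (c / (m + 1) + 1) ∧ c / (m + 1) ≤ n := by
  rcases hh with ⟨rfl, rfl⟩ | ⟨l, hl, rfl, rfl⟩
  · rw [code_div (by omega), ← hS.S_last]
    exact ⟨hS.S_lt hn (by omega) (by omega), le_rfl, le_rfl⟩
  · obtain ⟨g, h1, h2, h3, h4, h5⟩ := hst.label l hl
    rw [h2, code_div (by omega)]
    exact ⟨h4, h5.le, h1⟩

/-- Constructed backbones lie strictly inside their gaps, so the test that `dp` makes on codes
agrees with the geometry. The companion for upper borders follows. -/
theorem IsLow.gap_le_iff (hn : 0 < n) {h : ℝ} {c : ℕ} (hh : st.IsLow I h c) {j : ℕ} (hj : j < n) :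
    c / (m + 1) ≤ yr j ↔ h < I.py (ord j) := by
  obtain ⟨h1, h2, h3⟩ := hh.mem hS hst hn
  have := hS.yr_lt hj
  rw [← hS.S_yr hj]
  constructor
  · exact fun h => h2.trans_le (hS.S_le hn (by omega) (by omega))
  · intro h
    by_contra h'
    exact h.not_ge ((hS.S_le hn (by omega) (by omega)).trans h1)

theorem IsHigh.lt_gap_iff (hn : 0 < n) {h : ℝ} {c : ℕ} (hh : st.IsHigh I h c) {j : ℕ} (hj : j < n) :
    yr j < c / (m + 1) ↔ I.py (ord j) < h := by
  obtain ⟨h1, h2, h3⟩ := hh.mem hS hst hn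
  have := hS.yr_lt hj
  rw [← hS.S_yr hj]
  constructor
  · exact fun h => (hS.S_le hn (by omega) (by omega)).trans_lt h1
  · intro h
    by_contra h'
    exact h.not_ge (h2.trans (hS.S_le hn (by omega) (by omega)))

theorem height_mem (hn : 0 < n) {l : ℕ} (hl : l < st.cnt) :
    I.ymin < st.height l ∧ st.height l < I.ymax := by
  obtain ⟨g, h1, h2, h3, h4, h5⟩ := hst.label l hl
  rw [← hS.S_zero, ← hS.S_last]
  exact ⟨(hS.S_le hn (by omega) (by omega)).trans_lt h4,
    h5.trans_le (hS.S_le hn (by omega) (by omega))⟩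

theorem height_ne (hn : 0 < n) {l j : ℕ} (hl : l < st.cnt) (hj : j < n) :
    st.height l ≠ I.py (ord j) := by
  have h1 := IsLow.gap_le_iff hS hst hn (.inr ⟨l, hl, rfl, rfl⟩) hj
  have h2 := IsHigh.lt_gap_iff hS hst hn (.inr ⟨l, hl, rfl, rfl⟩) hj
  intro h
  rw [h] at h1 h2
  simp only [lt_irrefl, iff_false] at h1 h2
  omega

theorem IsLow.unique (hn : 0 < n) {h : ℝ} {c c' : ℕ} (hh : st.IsLow I h c)
    (hh' : st.IsLow I h c') : c = c' := by
  rcases hh with ⟨h1, h2⟩ | ⟨l, hl, h1, h2⟩ <;> rcases hh' with ⟨h1', h2'⟩ | ⟨l', hl', h1', h2'⟩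
  · rw [h2, h2']
  · exact absurd (h1.symm.trans h1') (height_mem hS hst hn hl').1.ne
  · exact absurd (h1'.symm.trans h1) (height_mem hS hst hn hl).1.ne
  · rw [h2, h2', hst.inj l hl l' hl' (h1.symm.trans h1')]

theorem IsHigh.unique (hn : 0 < n) {h : ℝ} {c c' : ℕ} (hh : st.IsHigh I h c)
    (hh' : st.IsHigh I h c') : c = c' := by
  rcases hh with ⟨h1, h2⟩ | ⟨l, hl, h1, h2⟩ <;> rcases hh' with ⟨h1', h2'⟩ | ⟨l', hl', h1', h2'⟩
  · rw [h2, h2']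
  · exact absurd (h1.symm.trans h1') (height_mem hS hst hn hl').2.ne'
  · exact absurd (h1'.symm.trans h1) (height_mem hS hst hn hl).2.ne'
  · rw [h2, h2', hst.inj l hl l' hl' (h1.symm.trans h1')]

/-- The dummy color `m` occurs at no point. A color match therefore rules out the side of the
rectangle and guarantees that the returned index is that of a label. -/
theorem lower_spec {j : ℕ} (hj : j < n) :
    let lo := lower I ord j st
    st.IsLow I lo.1 lo.2.1 ∧ lo.1 < I.py (ord j) ∧
      (∀ l < st.cnt, st.height l < I.py (ord j) → st.height l ≤ lo.1) ∧
      (lo.2.1 % (m + 1) ≠ m → lo.2.2 < st.cnt ∧ lo.1 = st.height lo.2.2 ∧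
        lo.2.1 % (m + 1) = st.color lo.2.2) := by
  have h := nearest_spec (· < ·) (fun _ _ _ => lt_trans) st.height st.code (I.py (ord j)) I.ymin m
    (py_mem (hS.ord_lt hj)).1 (fun _ => lt_irrefl _) st.cnt
  rw [← lower] at h
  refine ⟨h.1.imp_right fun h => ⟨_, h⟩, h.2.1, fun l hl h' => not_lt.1 (h.2.2 l hl h'), ?_⟩
  intro hm
  rcases h.1 with h' | h'
  · rw [h'.2, Nat.mod_eq_of_lt (by omega)] at hm
    exact absurd rfl hm
  · refine ⟨h'.1, h'.2.1, ?_⟩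
    obtain ⟨g, h1, h2, h3, h4, h5⟩ := hst.label _ h'.1
    rw [h'.2.2, h2, code_mod (by omega)]

theorem upper_spec {j : ℕ} (hj : j < n) :
    let hi := upper I ord j st
    st.IsHigh I hi.1 hi.2.1 ∧ I.py (ord j) < hi.1 ∧
      (∀ l < st.cnt, I.py (ord j) < st.height l → hi.1 ≤ st.height l) ∧
      (hi.2.1 % (m + 1) ≠ m → hi.2.2 < st.cnt ∧ hi.1 = st.height hi.2.2 ∧
        hi.2.1 % (m + 1) = st.color hi.2.2) := by
  have h := nearest_spec (· > ·) (fun _ _ _ => gt_trans) st.height st.code (I.py (ord j)) I.ymax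
    (n * (m + 1) + m) (py_mem (hS.ord_lt hj)).2 (fun _ => lt_irrefl _) st.cnt
  rw [← upper] at h
  refine ⟨h.1.imp_right fun h => ⟨_, h⟩, h.2.1, fun l hl h' => not_lt.1 (h.2.2 l hl h'), ?_⟩
  intro hm
  rcases h.1 with h' | h'
  · rw [h'.2, code_mod (by omega)] at hm
    exact absurd rfl hm
  · refine ⟨h'.1, h'.2.1, ?_⟩
    obtain ⟨g, h1, h2, h3, h4, h5⟩ := hst.label _ h'.1
    rw [h'.2.2, h2, code_mod (by omega)]

end

/-- Effect of one step of the sweep. -/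
theorem step_spec (hS : IsSorted I ord yr ck S) (hst : Valid I ord ck S (k + 1) st) :
    ∃ lo clo hi chi, st.Adjacent I lo clo hi chi ∧ lo < I.py (ord k) ∧ I.py (ord k) < hi ∧
      ((∃ l < st.cnt, step I ord yr ck S k st = st.connect (ord k) l ∧ st.color l = ck k ∧
          (st.height l = lo ∨ st.height l = hi) ∧
          (dp (m + 1) yr ck (k + 1) clo chi).1 = (dp (m + 1) yr ck k clo chi).1) ∨
        ∃ h g, g ≤ n ∧ step I ord yr ck S k st =
            st.addLabel (ord k) h (g * (m + 1) + ck k) (ck k) ∧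
          lo < h ∧ h < hi ∧ S g < h ∧ h < S (g + 1) ∧
          (dp (m + 1) yr ck (k + 1) clo chi).1 =
            1 + (dp (m + 1) yr ck k clo (g * (m + 1) + ck k)).1 +
              (dp (m + 1) yr ck k (g * (m + 1) + ck k) chi).1) := by
  have hk : k < n := by
    have := hst.cnt_le
    omega
  have hn : 0 < n := by omega
  obtain ⟨lo1, lo2, lo3, lo4⟩ := lower_spec hS hst hk
  obtain ⟨hi1, hi2, hi3, hi4⟩ := upper_spec hS hst hk
  have hlt := lo2.trans hi2
  refine ⟨_, _, _, _, ⟨lo1, hi1, hlt, fun l hl h => ?_⟩, lo2, hi2, ?_⟩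
  · rcases lt_or_gt_of_ne (height_ne hS hst hn hl hk) with h' | h'
    · exact (lo3 l hl h').not_gt h.1
    · exact (hi3 l hl h').not_gt h.2
  have hck := hS.ck_lt hk
  have hreg := And.intro ((lo1.gap_le_iff hS hst hn hk).2 lo2) ((hi1.lt_gap_iff hS hst hn hk).2 hi2)
  rcases dp_succ_spec (ck := ck) hreg with ⟨h1, h2, h3⟩ | ⟨g, h1, h2, h3, h4⟩
  · refine .inl ⟨_, ?_, by rw [step]; simp only [h1, if_true]; rfl, ?_, ?_, h3⟩
    all_goals split_ifs with hc
    · exact (hi4 (by omega)).1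
    · exact (lo4 (by omega)).1
    · exact (hi4 (by omega)).2.2.symm.trans hc.symm
    · exact (lo4 (by omega)).2.2.symm.trans (by omega)
    · exact .inr (hi4 (by omega)).2.1.symm
    · exact .inl (lo4 (by omega)).2.1.symm
  · obtain ⟨-, ml, ml'⟩ := lo1.mem hS hst hn
    obtain ⟨mh, -, mh'⟩ := hi1.mem hS hst hn
    have e1 := hS.S_lt hn (show g < g + 1 by omega) (by omega)
    have e2 := ml.trans_le (hS.S_le hn (show _ ≤ g + 1 by omega) (by omega))
    have e3 := (hS.S_le hn h3 (by omega)).trans_lt mh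
    -- Since `g` lies between the gaps of the two neighbors, the strip and the gap overlap in a
    -- nonempty open interval; the new height is its midpoint.
    have e4 : max (lower I ord k st).1 (S g) < min (upper I ord k st).1 (S (g + 1)) :=
      max_lt (lt_min hlt e2) (lt_min e3 e1)
    refine .inr ⟨(max (lower I ord k st).1 (S g) + min (upper I ord k st).1 (S (g + 1))) / 2,
      g, by omega, by rw [step]; simp [h1], ?_, ?_, ?_, ?_, h4⟩
    · linarith [le_max_left (lower I ord k st).1 (S g)]
    · linarith [min_le_left (upper I ord k st).1 (S (g + 1))]
    · linarith [le_max_right (lower I ord k st).1 (S g)]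
    · linarith [min_le_right (upper I ord k st).1 (S (g + 1))]

/-- The new connector runs through a strip without backbones and ends on its border. The new point
is to the right of all earlier connectors, so attaching it extends no backbone to the left. -/
theorem Valid.connect (hS : IsSorted I ord yr ck S) (hst : Valid I ord ck S (k + 1) st)
    {lo hi : ℝ} {clo chi l : ℕ} (hadj : st.Adjacent I lo clo hi chi) (h1 : lo < I.py (ord k))
    (h2 : I.py (ord k) < hi) (hl : l < st.cnt) (hc : st.color l = ck k)
    (hh : st.height l = lo ∨ st.height l = hi) :
    Valid I ord ck S k (st.connect (ord k) l) := by
  have hk : k < n := by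
    have := hst.cnt_le
    omega
  have hself : (st.connect (ord k) l).assign (ord k) = l := by simp [Sweep.connect]
  have hother : ∀ j, k + 1 ≤ j → j < n →
      (st.connect (ord k) l).assign (ord j) = st.assign (ord j) := fun j hj hj' => by
    have : ord j ≠ ord k := fun h => by
      have := hS.ord_inj hj' hk h
      omega
    simp [Sweep.connect, this]
  refine ⟨?_, hst.label, hst.inj, fun j hj hj' => ?_,
    fun j hj hj' l' hl' hne hmem j' hjj' hjn' ha => ?_⟩
  · have := hst.cnt_le
    simp only [Sweep.connect]
    omega
  · rcases hj.eq_or_lt with rfl | hj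
    · rw [hself]
      exact ⟨hl, hc⟩
    · rw [hother j hj hj']
      exact hst.assign j hj hj'
  · rcases hj.eq_or_lt with rfl | hj
    · rw [hself] at hne hmem
      change st.height l' ∈ Set.uIcc (I.py (ord k)) (st.height l) at hmem
      have hne' : st.height l' ≠ st.height l := fun h => hne (hst.inj l' hl' l hl h)
      exfalso
      apply hadj.empty l' hl'
      rw [Set.mem_uIcc] at hmem
      rcases hh with hh | hh <;> rw [hh] at hmem hne'
      · rcases hmem with h | h
        · linarith
        · exact ⟨lt_of_le_of_ne h.1 hne'.symm, by linarith⟩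
      · rcases hmem with h | h
        · exact ⟨by linarith, lt_of_le_of_ne h.2 hne'⟩
        · linarith
    · rw [hother j hj hj'] at hne hmem
      rcases hjj'.eq_or_lt with rfl | hjj'
      · omega
      · rw [hother j' hjj' hjn'] at ha
        exact hst.noncrossing j hj hj' l' hl' hne hmem j' hjj' hjn' ha

/-- Earlier connectors may pass the height of the new backbone, but the backbone starts to the right
of them. Its own connector stays inside an empty strip. -/
theorem Valid.addLabel (hS : IsSorted I ord yr ck S) (hst : Valid I ord ck S (k + 1) st)
    {lo hi h : ℝ} {clo chi g : ℕ} (hadj : st.Adjacent I lo clo hi chi) (h1 : lo < I.py (ord k))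
    (h2 : I.py (ord k) < hi) (hg : g ≤ n) (h3 : lo < h) (h4 : h < hi) (h5 : S g < h)
    (h6 : h < S (g + 1)) :
    Valid I ord ck S k (st.addLabel (ord k) h (g * (m + 1) + ck k) (ck k)) := by
  have hk : k < n := by
    have := hst.cnt_le
    omega
  set st' := st.addLabel (ord k) h (g * (m + 1) + ck k) (ck k) with hst'
  have hself : st'.assign (ord k) = st.cnt := by simp [hst', Sweep.addLabel]
  have hother : ∀ j, k + 1 ≤ j → j < n → st'.assign (ord j) = st.assign (ord j) :=
    fun j hj hj' => by
      have : ord j ≠ ord k := fun h => by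
        have := hS.ord_inj hj' hk h
        omega
      simp [hst', Sweep.addLabel, this]
  have hcnt : st'.cnt = st.cnt + 1 := rfl
  have hnew : st'.height st.cnt = h ∧ st'.code st.cnt = g * (m + 1) + ck k ∧
      st'.color st.cnt = ck k := by simp [hst', Sweep.addLabel]
  have hold : ∀ l < st.cnt, st'.height l = st.height l ∧ st'.code l = st.code l ∧
      st'.color l = st.color l := fun l hl => by simp [hst', Sweep.addLabel, hl.ne]
  have hcase : ∀ l < st'.cnt, l < st.cnt ∨ l = st.cnt := fun l hl => by omega
  have hne : ∀ l < st.cnt, st.height l ≠ h := fun l hl hl' =>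
    hadj.empty l hl ⟨by linarith, by linarith⟩
  refine ⟨?_, fun l hl => ?_, fun l hl l' hl' hll => ?_, fun j hj hj' => ?_,
    fun j hj hj' l' hl' hne' hmem j' hjj' hjn' ha => ?_⟩
  · have := hst.cnt_le
    omega
  · rcases hcase l hl with hl | rfl
    · rw [(hold l hl).1, (hold l hl).2.1, (hold l hl).2.2]
      exact hst.label l hl
    · rw [hnew.1, hnew.2.1, hnew.2.2]
      exact ⟨g, hg, rfl, hS.ck_lt hk, h5, h6⟩
  · rcases hcase l hl with hl | rfl <;> rcases hcase l' hl' with hl' | rfl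
    · rw [(hold l hl).1, (hold l' hl').1] at hll
      exact hst.inj l hl l' hl' hll
    · rw [(hold l hl).1, hnew.1] at hll
      exact absurd hll (hne l hl)
    · rw [(hold l' hl').1, hnew.1] at hll
      exact absurd hll.symm (hne l' hl')
    · rfl
  · rcases hj.eq_or_lt with rfl | hj
    · rw [hself, hnew.2.2]
      exact ⟨by omega, rfl⟩
    · rw [hother j hj hj']
      have := hst.assign j hj hj'
      rw [(hold _ this.1).2.2]
      exact ⟨by omega, this.2⟩
  · rcases hj.eq_or_lt with rfl | hj
    · rw [hself] at hne' hmem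
      rw [hnew.1] at hmem
      have hl := (hcase l' hl').resolve_right hne'
      rw [(hold l' hl).1] at hmem
      have hne'' := hne l' hl
      exfalso
      apply hadj.empty l' hl
      rw [Set.mem_uIcc] at hmem
      rcases hmem with h | h
      · exact ⟨by linarith, by linarith⟩
      · exact ⟨by linarith, by linarith⟩
    · rcases hjj'.eq_or_lt with rfl | hjj'
      · omega
      · rw [hother j' hjj' hjn'] at ha
        have hl : l' < st.cnt := ha ▸ (hst.assign j' hjj' hjn').1
        rw [hother j hj hj'] at hne' hmem
        rw [(hold l' hl).1, (hold _ (hst.assign j hj hj').1).1] at hmem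
        exact hst.noncrossing j hj hj' l' hl hne' hmem j' hjj' hjn' ha

/-- If two strips around `z` differed, a border of one would be a backbone inside the other. Hence
one step of the sweep affects a single strip. -/
theorem Adjacent.unique (hS : IsSorted I ord yr ck S) (hst : Valid I ord ck S k st) (hn : 0 < n)
    {a b a' b' z : ℝ} {ca cb ca' cb' : ℕ} (h : st.Adjacent I a ca b cb)
    (h' : st.Adjacent I a' ca' b' cb') (hz : a < z ∧ z < b) (hz' : a' < z ∧ z < b') :
    a = a' ∧ ca = ca' ∧ b = b' ∧ cb = cb' := by
  have low : ∀ {a b a' b' : ℝ} {ca cb ca' cb' : ℕ}, st.Adjacent I a ca b cb →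
      st.Adjacent I a' ca' b' cb' → z < b' → a < z → a ≤ a' := by
    intro a b a' b' ca cb ca' cb' h h' hz hz'
    rcases h.low with ⟨h1, -⟩ | ⟨l, hl, h1, -⟩
    · rcases h'.low with ⟨h2, -⟩ | ⟨l', hl', h2, -⟩
      · rw [h1, h2]
      · rw [h1, h2]
        exact (height_mem hS hst hn hl').1.le
    · by_contra hlt
      exact h'.empty l hl ⟨by linarith, by linarith⟩
  have high : ∀ {a b a' b' : ℝ} {ca cb ca' cb' : ℕ}, st.Adjacent I a ca b cb →
      st.Adjacent I a' ca' b' cb' → a' < z → z < b → b' ≤ b := by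
    intro a b a' b' ca cb ca' cb' h h' hz hz'
    rcases h.high with ⟨h1, -⟩ | ⟨l, hl, h1, -⟩
    · rcases h'.high with ⟨h2, -⟩ | ⟨l', hl', h2, -⟩
      · rw [h1, h2]
      · rw [h1, h2]
        exact (height_mem hS hst hn hl').2.le
    · by_contra hlt
      exact h'.empty l hl ⟨by linarith, by linarith⟩
  obtain rfl := le_antisymm (low h h' hz'.2 hz.1) (low h' h hz.2 hz'.1)
  obtain rfl := le_antisymm (high h' h hz.1 hz'.2) (high h h' hz'.1 hz.2)
  exact ⟨rfl, h.low.unique hS hst hn h'.low, rfl, h.high.unique hS hst hn h'.high⟩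

/-- The sweep keeps the labels and adds `dp` labels between any two consecutive ones. -/
theorem run_spec (hS : IsSorted I ord yr ck S) (k : ℕ) (st : Sweep)
    (hst : Valid I ord ck S k st) :
    Valid I ord ck S 0 (run I ord yr ck S k st) ∧ st.cnt ≤ (run I ord yr ck S k st).cnt ∧
      (∀ l < st.cnt, (run I ord yr ck S k st).height l = st.height l) ∧
      ∀ h c h' c', st.Adjacent I h c h' c' →
        ((Finset.range (run I ord yr ck S k st).cnt).filter fun l =>
          h < (run I ord yr ck S k st).height l ∧ (run I ord yr ck S k st).height l < h').card =
        (dp (m + 1) yr ck k c c').1 := by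
  induction k generalizing st with
  | zero =>
    refine ⟨hst, le_rfl, fun _ _ => rfl, fun h c h' c' hadj => ?_⟩
    rw [dp, Finset.card_eq_zero, Finset.filter_eq_empty_iff]
    exact fun l hl => hadj.empty l (Finset.mem_range.1 hl)
  | succ k ih =>
    have hk : k < n := by
      have := hst.cnt_le
      omega
    have hn : 0 < n := by omega
    have hregion : ∀ {a ca b cb}, st.Adjacent I a ca b cb →
        ((ca / (m + 1) ≤ yr k ∧ yr k < cb / (m + 1)) ↔
          (a < I.py (ord k) ∧ I.py (ord k) < b)) := fun hab => by
      rw [hab.low.gap_le_iff hS hst hn hk, hab.high.lt_gap_iff hS hst hn hk]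
    rw [run]
    obtain ⟨lo, clo, hi, chi, hadj, h1, h2, ⟨l, hl, hstep, hc, hh, hdp⟩ |
      ⟨h, g, hg, hstep, h3, h4, h5, h6, hdp⟩⟩ := step_spec hS hst
    · rw [hstep]
      obtain ⟨e1, e2, e3, e4⟩ := ih _ (hst.connect hS hadj h1 h2 hl hc hh)
      refine ⟨e1, e2, e3, fun a ca b cb hab => ?_⟩
      rw [e4 a ca b cb ⟨hab.low, hab.high, hab.lt, hab.empty⟩]
      -- Only the strip around the point uses the decision; in all others `dp` skips the point.
      by_cases hreg : ca / (m + 1) ≤ yr k ∧ yr k < cb / (m + 1)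
      · obtain ⟨rfl, rfl, rfl, rfl⟩ :=
          hab.unique hS hst hn hadj ((hregion hab).1 hreg) ⟨h1, h2⟩
        exact hdp.symm
      · rw [dp_succ_of_not hreg]
    · rw [hstep]
      obtain ⟨e1, e2, e3, e4⟩ := ih _ (hst.addLabel hS hadj h1 h2 hg h3 h4 h5 h6)
      set st' := st.addLabel (ord k) h (g * (m + 1) + ck k) (ck k) with hst'
      set fin := run I ord yr ck S k st'
      have hcnt : st'.cnt = st.cnt + 1 := rfl
      have hnew : st'.height st.cnt = h ∧ st'.code st.cnt = g * (m + 1) + ck k := by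
        simp [hst', Sweep.addLabel]
      have hold : ∀ l < st.cnt, st'.height l = st.height l ∧ st'.code l = st.code l :=
        fun l hl => by simp [hst', Sweep.addLabel, hl.ne]
      have hlow : ∀ {a ca}, st.IsLow I a ca → st'.IsLow I a ca := fun ha =>
        ha.imp_right fun ⟨l, hl, h⟩ => ⟨l, by omega, by rwa [(hold l hl).1, (hold l hl).2]⟩
      have hhigh : ∀ {a ca}, st.IsHigh I a ca → st'.IsHigh I a ca := fun ha =>
        ha.imp_right fun ⟨l, hl, h⟩ => ⟨l, by omega, by rwa [(hold l hl).1, (hold l hl).2]⟩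
      have hempty : ∀ {a b : ℝ}, ¬ (a < h ∧ h < b) →
          (∀ l < st.cnt, ¬ (a < st.height l ∧ st.height l < b)) →
          ∀ l < st'.cnt, ¬ (a < st'.height l ∧ st'.height l < b) := by
        intro a b hab hemp l hl
        rcases Nat.lt_succ_iff_lt_or_eq.1 hl with hl | rfl
        · rw [(hold l hl).1]
          exact hemp l hl
        · rwa [hnew.1]
      refine ⟨e1, by omega, fun l hl => by rw [e3 l (by omega), (hold l hl).1],
        fun a ca b cb hab => ?_⟩
      by_cases hreg : ca / (m + 1) ≤ yr k ∧ yr k < cb / (m + 1)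
      · obtain ⟨rfl, rfl, rfl, rfl⟩ :=
          hab.unique hS hst hn hadj ((hregion hab).1 hreg) ⟨h1, h2⟩
        have hmem : st.cnt < st'.cnt := by omega
        have f1 := e4 a ca h (g * (m + 1) + ck k)
          ⟨hlow hab.low, .inr ⟨st.cnt, hmem, hnew.1.symm, hnew.2.symm⟩, h3,
            hempty (fun h => lt_irrefl _ h.2) fun l hl h' =>
              hab.empty l hl ⟨h'.1, h'.2.trans h4⟩⟩
        have f2 := e4 h (g * (m + 1) + ck k) b cb
          ⟨.inr ⟨st.cnt, hmem, hnew.1.symm, hnew.2.symm⟩, hhigh hab.high, h4,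
            hempty (fun h => lt_irrefl _ h.1) fun l hl h' =>
              hab.empty l hl ⟨h3.trans h'.1, h'.2⟩⟩
        have fh : fin.height st.cnt = h := by rw [e3 _ hmem, hnew.1]
        rw [hdp, ← f1, ← f2]
        -- The final labels of the old strip are the new label and those of the two parts; heights
        -- are injective, so no other label has height `h`.
        have hset : ((Finset.range fin.cnt).filter fun l => a < fin.height l ∧ fin.height l < b) =
            insert st.cnt
              (((Finset.range fin.cnt).filter fun l => a < fin.height l ∧ fin.height l < h) ∪
              (Finset.range fin.cnt).filter fun l => h < fin.height l ∧ fin.height l < b) := by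
          ext l
          simp only [Finset.mem_insert, Finset.mem_union, Finset.mem_filter, Finset.mem_range]
          constructor
          · rintro ⟨hl, hl1, hl2⟩
            rcases lt_trichotomy (fin.height l) h with h' | h' | h'
            · exact .inr (.inl ⟨hl, hl1, h'⟩)
            · exact .inl (e1.inj l hl _ (by omega) (h'.trans fh.symm))
            · exact .inr (.inr ⟨hl, h', hl2⟩)
          · rintro (rfl | h' | h')
            · rw [fh]
              exact ⟨by omega, h3, h4⟩
            · exact ⟨h'.1, h'.2.1, h'.2.2.trans h4⟩
            · exact ⟨h'.1, h3.trans h'.2.1, h'.2.2⟩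
        rw [hset, Finset.card_insert_of_notMem (by simp [fh]), Finset.card_union_of_disjoint]
        · omega
        · rw [Finset.disjoint_filter]
          intro l _ h h'
          linarith [h.2, h'.1]
      · rw [dp_succ_of_not hreg]
        -- The new backbone is not inside this strip, which would otherwise coincide with the strip
        -- around the point.
        refine e4 a ca b cb ⟨hlow hab.low, hhigh hab.high, hab.lt, hempty (fun hh => hreg ?_)
          hab.empty⟩
        obtain ⟨rfl, rfl, rfl, rfl⟩ := hab.unique hS hst hn hadj hh ⟨h3, h4⟩
        exact (hregion hab).2 ⟨h1, h2⟩

/-- The labeling that a sweep has constructed. -/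
def toLabeling (hS : IsSorted I ord yr ck S) (hst : Valid I ord ck S 0 st) : Labeling n m where
  numLabels := st.cnt
  color l := ⟨st.color l, by
    obtain ⟨g, h1, h2, h3, h4⟩ := hst.label l l.2
    exact h3⟩
  y l := st.height l
  assign i := ⟨st.assign i, by
    have := (hst.assign (I.rx i) (Nat.zero_le _) (rx_lt i.2)).1
    rwa [hS.ord_rx i i.2] at this⟩

/-- Backbones have distinct heights and connectors distinct abscissas, so only a connector and a
foreign backbone could meet; the invariant `noncrossing` then places all points of that backbone
strictly to the right of the connector. -/
theorem isCrossingFree_toLabeling (hS : IsSorted I ord yr ck S)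
    (hst : Valid I ord ck S 0 st) : I.IsCrossingFree (toLabeling hS hst) := by
  have hback : ∀ i : Fin n, ∀ l' : Fin st.cnt, (toLabeling hS hst).assign i ≠ l' →
      Disjoint (I.connector (toLabeling hS hst) i) (I.backbone (toLabeling hS hst) l') := by
    intro i l' hne
    rw [Set.disjoint_left]
    rintro ⟨x, y⟩ ⟨h1, h2⟩ ⟨h3, h4, j, h5, h6⟩
    dsimp only at h1 h2 h3 h4 h6
    rw [← px_val] at h1 h6
    rw [← py_val] at h2
    have hoi := hS.ord_rx i i.2
    have hoj := hS.ord_rx j j.2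
    have := hst.noncrossing (I.rx i) (Nat.zero_le _) (rx_lt i.2) l' l'.2
      (by rw [hoi]; exact fun h => hne (Fin.ext h.symm)) (by rw [hoi]; rw [h3] at h2; exact h2)
      (I.rx j) (Nat.zero_le _) (rx_lt j.2) (by rw [hoj]; exact congrArg Fin.val h5)
    rcases (h1 ▸ h6 : I.px j ≤ I.px i).lt_or_eq with h | h
    · have := rx_lt_rx i.2 h
      omega
    · rw [px_inj j.2 i.2 h] at this
      omega
  refine ⟨fun l => ?_, fun i => ?_, fun l l' hll => ?_⟩
  · have hn : 0 < n := l.pos.trans_le hst.cnt_le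
    exact ⟨(height_mem hS hst hn l.2).1.le, (height_mem hS hst hn l.2).2.le⟩
  · have h := (hst.assign (I.rx i) (Nat.zero_le _) (rx_lt i.2)).2
    rw [hS.ord_rx i i.2, hS.ck_rx i i.2, pc_val] at h
    exact Fin.ext h
  · rw [leader, leader, Set.disjoint_union_left, Set.disjoint_union_right,
      Set.disjoint_union_right]
    simp only [Set.disjoint_iUnion_left, Set.disjoint_iUnion_right]
    refine ⟨⟨?_, fun i hi => (hback i l ?_).symm⟩, fun i hi => hback i l' ?_, fun i hi j hj => ?_⟩
    · rw [Set.disjoint_left]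
      rintro z ⟨h1, -⟩ ⟨h2, -⟩
      exact hll (Fin.ext (hst.inj l l.2 l' l'.2 (h1.symm.trans h2)))
    · exact fun h => hll (h.symm.trans hi)
    · exact fun h => hll (hi.symm.trans h)
    · rw [Set.disjoint_left]
      rintro z ⟨h1, -⟩ ⟨h2, -⟩
      have : i = j := I.x_injective (h2.symm.trans h1)
      subst this
      exact hll (hj.symm.trans hi)

/-- The initial strip is the whole rectangle. The number of labels constructed is its table entry,
which bounds the number of labels of every competitor from below. -/
theorem exists_isOptimal (hS : IsSorted I ord yr ck S) :
    ∃ L : Labeling n m, I.IsOptimal L ∧ L.numLabels = (run I ord yr ck S n init).cnt ∧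
      (∀ i : Fin n, (L.assign i : ℕ) = (run I ord yr ck S n init).assign i) ∧
      (∀ l : Fin L.numLabels, (L.color l : ℕ) = (run I ord yr ck S n init).color l) ∧
      ∀ l : Fin L.numLabels, L.y l = (run I ord yr ck S n init).height l := by
  obtain ⟨h1, -, -, h2⟩ := run_spec hS n init .init
  refine ⟨toLabeling hS h1, ⟨isCrossingFree_toLabeling hS h1, fun L' hL' => ?_⟩, rfl,
    fun _ => rfl, fun _ => rfl, fun _ => rfl⟩
  refine le_trans ?_ (dp_le_numLabels hS hL')
  change (run I ord yr ck S n init).cnt ≤ _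
  rcases Nat.eq_zero_or_pos n with rfl | hn
  · have := h1.cnt_le
    omega
  · rw [← h2 I.ymin m I.ymax (n * (m + 1) + m) ⟨.inl ⟨rfl, rfl⟩, .inl ⟨rfl, rfl⟩,
      ymin_lt_ymax hn, fun l hl => by simp [init] at hl⟩, Finset.filter_true_of_mem,
      Finset.card_range]
    exact fun l hl => height_mem hS h1 hn (Finset.mem_range.1 hl)

end Sweep

/-! ### The program -/

attribute [simp] State.setI_ivar State.setI_imem State.setI_rvar State.setI_rmem State.setR_ivar
  State.setR_imem State.setR_rvar State.setR_rmem State.writeI_ivar State.writeI_imem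
  State.writeI_rvar State.writeI_rmem State.writeR_ivar State.writeR_imem State.writeR_rvar
  State.writeR_rmem Prog.wp IExp.eval IExp.Fits RExp.eval RExp.Fits Test.Holds Test.Fits

/-- Sequential composition of a list of programs. -/
def block : List Prog → Prog
  | [] => .skip
  | [p] => p
  | p :: q :: l => .seq p (block (q :: l))

attribute [simp] block

/-- The program increments integer variable `v`. -/
def incr (v : ℕ) : Prog := .iset v (.add (.var v) (.const 1))

attribute [simp] incr

variable {n m W : ℕ}

/-- The part of the memory that stays fixed until the output is written. -/
structure Fixed (I : ColoredPoints n m) (s : State) : Prop where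
  size : s.ivar 0 = n
  numColors : s.ivar 1 = m
  colors : s.ivar 10 = m + 1
  codes : s.ivar 11 = (n + 1) * (m + 1)
  ymin : s.rvar 2 = I.ymin
  ymax : s.rvar 3 = I.ymax
  px : s.rmem 0 = I.px
  py : s.rmem 1 = I.py

/-- The arrays of the later phases have not been used yet. -/
structure Unused (s : State) : Prop where
  imem_one : s.imem 1 = fun _ => 0
  imem_two : s.imem 2 = fun _ => 0
  imem_five : s.imem 5 = fun _ => 0
  imem_six : s.imem 6 = fun _ => 0
  imem_seven : s.imem 7 = fun _ => 0
  rmem_two : s.rmem 2 = fun _ => 0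

/-- Frame rule: the default arguments discharge the equalities for all locations that the code in
question does not write. The other `congr` lemmas play the same role. -/
theorem Fixed.congr {I : ColoredPoints n m} {s s' : State} (h : Fixed I s)
    (h0 : s'.ivar 0 = s.ivar 0 := by simp) (h1 : s'.ivar 1 = s.ivar 1 := by simp)
    (h10 : s'.ivar 10 = s.ivar 10 := by simp)
    (h11 : s'.ivar 11 = s.ivar 11 := by simp) (r2 : s'.rvar 2 = s.rvar 2 := by simp)
    (r3 : s'.rvar 3 = s.rvar 3 := by simp)
    (m0 : s'.rmem 0 = s.rmem 0 := by simp) (m1 : s'.rmem 1 = s.rmem 1 := by simp) : Fixed I s' :=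
  ⟨h0 ▸ h.size, h1 ▸ h.numColors, h10 ▸ h.colors, h11 ▸ h.codes, r2 ▸ h.ymin, r3 ▸ h.ymax, m0 ▸ h.px,
    m1 ▸ h.py⟩

theorem Unused.congr {s s' : State} (h : Unused s) (h1 : s'.imem 1 = s.imem 1 := by simp)
    (h2 : s'.imem 2 = s.imem 2 := by simp) (h5 : s'.imem 5 = s.imem 5 := by simp)
    (h6 : s'.imem 6 = s.imem 6 := by simp)
    (h7 : s'.imem 7 = s.imem 7 := by simp) (r2 : s'.rmem 2 = s.rmem 2 := by simp) : Unused s' :=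
  ⟨h1 ▸ h.imem_one, h2 ▸ h.imem_two, h5 ▸ h.imem_five, h6 ▸ h.imem_six, h7 ▸ h.imem_seven,
    r2 ▸ h.rmem_two⟩

/-! #### Sorting -/

/-- Compare point `var 2` with point `var 3`. -/
def compareBody : Prog := block [
  .ite (.rlt (.read 0 (.var 2)) (.read 0 (.var 3))) (incr 4) .skip,
  .ite (.rlt (.read 1 (.var 3)) (.read 1 (.var 2))) (incr 5) .skip,
  incr 3]

def sortPre : Prog := block [.iset 3 (.const 0), .iset 4 (.const 0), .iset 5 (.const 0)]

def sortPost : Prog := block [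
  .iwrite 3 (.var 4) (.var 2),
  .iwrite 4 (.var 4) (.var 5),
  .iwrite 8 (.var 4) (.read 0 (.var 2)),
  .rwrite 3 (.add (.var 5) (.const 1)) (.read 1 (.var 2)),
  incr 2]

/-- The two ranks of a point are counted by comparing it with all points and then serve directly as
array addresses; no sorting algorithm is needed, as quadratic time is affordable. -/
def sortBody : Prog :=
  .seq sortPre (.seq (.loop (.ilt (.var 3) (.var 0)) compareBody) sortPost)

/-- Invariant of the sorting phase after `i` points. -/
structure SortInv (I : ColoredPoints n m) (i : ℕ) (s : State) : Prop where
  fixed : Fixed I s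
  unused : Unused s
  pc : s.imem 0 = I.pc
  counter : s.ivar 2 = i
  ord : ∀ j < i, s.imem 3 (I.rx j) = j
  yr : ∀ j < i, s.imem 4 (I.rx j) = I.ry j
  ck : ∀ j < i, s.imem 8 (I.rx j) = I.pc j
  S : ∀ j < i, s.rmem 3 (I.ry j + 1) = I.py j
  S_zero : s.rmem 3 0 = I.ymin
  S_last : s.rmem 3 (n + 1) = I.ymax

structure CompareInv (I : ColoredPoints n m) (i j : ℕ) (s : State) : Prop where
  sort : SortInv I i s
  counter : s.ivar 3 = j
  rx : s.ivar 4 = ((Finset.range j).filter fun j => I.px i < I.px j).card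
  ry : s.ivar 5 = ((Finset.range j).filter fun j => I.py j < I.py i).card

theorem SortInv.congr {I : ColoredPoints n m} {i : ℕ} {s s' : State} (h : SortInv I i s)
    (hf : Fixed I s') (hm : s'.imem = s.imem := by rfl) (hr : s'.rmem = s.rmem := by rfl)
    (h2 : s'.ivar 2 = s.ivar 2 := by simp) : SortInv I i s' where
  fixed := hf
  unused := h.unused.congr (by rw [hm]) (by rw [hm]) (by rw [hm]) (by rw [hm]) (by rw [hm])
    (by rw [hr])
  pc := by rw [hm, h.pc]
  counter := by rw [h2, h.counter]
  ord := by rw [hm]; exact h.ord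
  yr := by rw [hm]; exact h.yr
  ck := by rw [hm]; exact h.ck
  S := by rw [hr]; exact h.S
  S_zero := by rw [hr]; exact h.S_zero
  S_last := by rw [hr]; exact h.S_last

theorem card_filter_range_succ (p : ℕ → Prop) [DecidablePred p] (j : ℕ) :
    ((Finset.range (j + 1)).filter p).card =
      ((Finset.range j).filter p).card + if p j then 1 else 0 := by
  rw [Finset.range_add_one, Finset.filter_insert]
  split_ifs <;> simp

theorem card_filter_range_le (p : ℕ → Prop) [DecidablePred p] (j : ℕ) :
    ((Finset.range j).filter p).card ≤ j :=
  (Finset.card_filter_le _ _).trans (Finset.card_range j).le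

theorem compareBody_runs (hW : n + m + 2 < W) {I : ColoredPoints n m} {i j : ℕ} (hi : i < n)
    (hj : j < n) {s : State} (h : CompareInv I i j s) :
    Runs W compareBody s compareBody.time (CompareInv I i (j + 1)) := by
  apply Runs.of_wp
  have hx := h.sort.fixed.px
  have hy := h.sort.fixed.py
  have h2 := h.sort.counter
  have h3 := h.counter
  have h4 := h.rx
  have h5 := h.ry
  have b4 := card_filter_range_le (fun j => I.px i < I.px j) j
  have b5 := card_filter_range_le (fun j => I.py j < I.py i) j
  have s4 := card_filter_range_succ (fun j => I.px i < I.px j) j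
  have s5 := card_filter_range_succ (fun j => I.py j < I.py i) j
  simp [compareBody, hx, hy, h2, h3, h4, h5]
  refine ⟨by omega, fun hlt => ⟨by omega, by omega, fun hlt' => ⟨by omega, by omega, ?_⟩,
    fun hlt' => ⟨by omega, ?_⟩⟩, fun hlt => ⟨by omega, fun hlt' => ⟨by omega, by omega, ?_⟩,
      fun hlt' => ⟨by omega, ?_⟩⟩⟩
  all_goals
    exact ⟨h.sort.congr h.sort.fixed.congr, by simp, by simp [*], by simp [*]⟩

/-- Time for one round of the sorting phase. -/
def sortTime (n : ℕ) : ℕ :=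
  sortPre.time + (n * ((Test.ilt (.var 3) (.var 0)).cost + compareBody.time + 1) +
    ((Test.ilt (.var 3) (.var 0)).cost + 1) + sortPost.time)

theorem sortBody_runs (hW : n + m + 2 < W) {I : ColoredPoints n m} {i : ℕ} (hi : i < n)
    {s : State} (h : SortInv I i s) :
    Runs W sortBody s (sortTime n) (SortInv I (i + 1)) := by
  refine Runs.seq_loop_seq (CompareInv I i) n _ ?_ ?_ ?_
  · simp [sortPre]
    exact ⟨by omega, h.congr h.fixed.congr, by simp, by simp, by simp⟩
  · intro j hj s h
    refine ⟨?_, ?_, compareBody_runs hW hi hj h⟩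
    · simp [h.counter, h.sort.fixed.size]
      omega
    · simpa [h.counter, h.sort.fixed.size] using hj
  · rintro s ⟨h, h3, h4, h5⟩
    have h0 := h.fixed.size
    have h2 := h.counter
    have h4 : s.ivar 4 = I.rx i := h4
    have h5 : s.ivar 5 = I.ry i := h5
    have b4 := rx_lt (I := I) hi
    have b5 := ry_lt (I := I) hi
    have bc := pc_lt (I := I) hi
    refine ⟨?_, ?_, ?_⟩
    · simp [h3, h0]
      omega
    · simp [h3, h0]
    · simp [sortPost, h2, h4, h5, h.pc, h.fixed.py]
      -- Distinct points have distinct ranks, so writing the data of point `i` overwrites no earlier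
      -- entry.
      have hx : ∀ j < i + 1, j ≠ i → I.rx j ≠ I.rx i := fun j hj hne h =>
        hne (rx_inj (by omega) hi h)
      have hy : ∀ j < i + 1, j ≠ i → I.ry j ≠ I.ry i := fun j hj hne h =>
        hne (ry_inj (by omega) hi h)
      repeat' apply And.intro
      all_goals try omega
      refine ⟨h.fixed.congr, h.unused.congr, by simpa using h.pc, by simp, fun j hj => ?_,
        fun j hj => ?_, fun j hj => ?_, fun j hj => ?_, by simpa using h.S_zero, ?_⟩
      · by_cases hj' : j = i
        · simp [hj']
        · simpa [hx j hj hj'] using h.ord j (by omega)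
      · by_cases hj' : j = i
        · simp [hj']
        · simpa [hx j hj hj'] using h.yr j (by omega)
      · by_cases hj' : j = i
        · simp [hj']
        · simpa [hx j hj hj'] using h.ck j (by omega)
      · by_cases hj' : j = i
        · simp [hj']
        · simpa [hy j hj hj'] using h.S j (by omega)
      · simpa [b5.ne'] using h.S_last

def initPart : Prog := block [
  .iset 10 (.add (.var 1) (.const 1)),
  .iset 11 (.mul (.add (.var 0) (.const 1)) (.var 10)),
  .rwrite 3 (.const 0) (.var 2),
  .rwrite 3 (.add (.var 0) (.const 1)) (.var 3),
  .iset 2 (.const 0)]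

theorem initPart_wp (hW : n + m + 2 < W) (hW' : (n + 1) * (m + 1) < W) (I : ColoredPoints n m) :
    initPart.wp W (SortInv I 0) (inputState I) := by
  have e0 : (inputState I).ivar 0 = n := rfl
  have e1 : (inputState I).ivar 1 = m := rfl
  simp [initPart, e0, e1]
  repeat' apply And.intro
  all_goals try omega
  refine ⟨?_, ?_, rfl, by simp, ?_, ?_, ?_, ?_, by simp; rfl, by simp; rfl⟩
  · refine ⟨by simp [e0], by simp [e1], by simp, by simp, by simp; rfl, by simp; rfl, rfl, rfl⟩
  · exact ⟨rfl, rfl, rfl, rfl, rfl, rfl⟩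
  all_goals exact fun j hj => absurd hj (Nat.not_lt_zero j)

/-- The memory holds the sorted points. -/
structure HoldsSorted (ord yr ck : ℕ → ℕ) (S : ℕ → ℝ) (s : State) : Prop where
  ord : s.imem 3 = ord
  yr : s.imem 4 = yr
  ck : s.imem 8 = ck
  S : s.rmem 3 = S

theorem HoldsSorted.congr {ord yr ck : ℕ → ℕ} {S : ℕ → ℝ} {s s' : State}
    (h : HoldsSorted ord yr ck S s) (h3 : s'.imem 3 = s.imem 3 := by simp)
    (h4 : s'.imem 4 = s.imem 4 := by simp) (h8 : s'.imem 8 = s.imem 8 := by simp)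
    (r3 : s'.rmem 3 = s.rmem 3 := by simp) : HoldsSorted ord yr ck S s' :=
  ⟨h3 ▸ h.ord, h4 ▸ h.yr, h8 ▸ h.ck, r3 ▸ h.S⟩

/-- The arrays for the labels and the assignment have not been used yet. -/
structure NoLabels (s : State) : Prop where
  assign : s.imem 1 = fun _ => 0
  color : s.imem 2 = fun _ => 0
  code : s.imem 7 = fun _ => 0
  height : s.rmem 2 = fun _ => 0

theorem NoLabels.congr {s s' : State} (h : NoLabels s) (h1 : s'.imem 1 = s.imem 1 := by simp)
    (h2 : s'.imem 2 = s.imem 2 := by simp) (h7 : s'.imem 7 = s.imem 7 := by simp)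
    (r2 : s'.rmem 2 = s.rmem 2 := by simp) : NoLabels s' :=
  ⟨h1 ▸ h.assign, h2 ▸ h.color, h7 ▸ h.code, r2 ▸ h.height⟩

/-! #### Filling the table -/

/-- The entry at index `j` of the table for `N` codes, whose row `k` consists of the values
`dp M yr ck k b t`. -/
def cell (N M : ℕ) (yr ck : ℕ → ℕ) (j : ℕ) : ℕ × ℕ :=
  dp M yr ck (j / N / N) (j / N % N) (j % N)

theorem cell_index {N b t : ℕ} (M : ℕ) (yr ck : ℕ → ℕ) (k : ℕ) (hb : b < N) (ht : t < N) :
    cell N M yr ck ((k * N + b) * N + t) = dp M yr ck k b t := by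
  rw [cell, code_div ht, code_mod ht, code_div hb, code_mod hb]

theorem index_lt {N k k' b t : ℕ} (hk : k < k') (hb : b < N) (ht : t < N) :
    (k * N + b) * N + t < k' * N * N := by
  have h1 : k * N + b + 1 ≤ k' * N := by
    have : (k + 1) * N ≤ k' * N := Nat.mul_le_mul_right _ hk
    rw [Nat.succ_mul] at this
    omega
  have h2 : (k * N + b + 1) * N ≤ k' * N * N := Nat.mul_le_mul_right _ h1
  rw [Nat.succ_mul] at h2
  omega

theorem code_lt {n m g c : ℕ} (hg : g ≤ n) (hc : c ≤ m) :
    g * (m + 1) + c < (n + 1) * (m + 1) := by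
  have : g * (m + 1) ≤ n * (m + 1) := Nat.mul_le_mul_right _ hg
  rw [Nat.succ_mul]
  omega

/-- Index of the table entry for `b` and `t` in row `k`. -/
def indexExp (k b t : IExp) : IExp := .add (.mul (.add (.mul k (.var 11)) b) (.var 11)) t

/-- Beyond the three arguments, all intermediate values are bounded by the size of the table, so a
single bound on `W` excludes overflow. -/
theorem indexExp_spec {N k' : ℕ} (hW : k' * N * N < W) {s : State} {k b t : IExp} {kv bv tv : ℕ}
    (hN : s.ivar 11 = N) (hk : k.Fits W s) (hb : b.Fits W s) (ht : t.Fits W s)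
    (ek : k.eval s = kv) (eb : b.eval s = bv) (et : t.eval s = tv) (lk : kv < k') (lb : bv < N)
    (lt : tv < N) :
    (indexExp k b t).Fits W s ∧ (indexExp k b t).eval s = (kv * N + bv) * N + tv := by
  have h := index_lt lk lb lt
  have hN1 : 1 ≤ N := by omega
  have h1 : (kv * N + bv) ≤ (kv * N + bv) * N := Nat.le_mul_of_pos_right _ hN1
  have h2 : N ≤ k' * N * N := by
    have : 1 ≤ k' * N := Nat.mul_pos (by omega) hN1
    exact Nat.le_mul_of_pos_left _ this
  simp only [indexExp, IExp.Fits, IExp.eval, ek, eb, et, hN]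
  exact ⟨⟨⟨⟨⟨hk, by omega, by omega⟩, hb, by omega⟩, by omega, by omega⟩, ht, by omega⟩, trivial⟩

/-- The code of a backbone in gap `g` with the color in variable `9`. -/
def codeExp (g : IExp) : IExp := .add (.mul g (.var 10)) (.var 9)

/-- The number of labels if the current point starts a backbone in gap `g`. -/
def candExp (g : IExp) : IExp :=
  .add (.add (.const 1) (.read 5 (indexExp (.var 6) (.var 5) (codeExp g))))
    (.read 5 (indexExp (.var 6) (codeExp g) (.var 4)))

def decode : Prog := block [
  .iset 4 (.mod (.var 2) (.var 11)),
  .iset 5 (.mod (.div (.var 2) (.var 11)) (.var 11)),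
  .iset 6 (.div (.div (.var 2) (.var 11)) (.var 11)),
  .iset 7 (.div (.var 5) (.var 10)),
  .iset 8 (.div (.var 4) (.var 10)),
  .iset 9 (.read 8 (.var 6))]

def startSplit : Prog := block [
  .iset 16 (candExp (.var 7)),
  .iset 17 (.var 7),
  .iset 3 (.add (.var 7) (.const 1))]

def tablePre : Prog := .seq decode startSplit

def splitTest : Test := .ilt (.var 3) (.add (.var 8) (.const 1))

def splitBody : Prog := block [
  .iset 18 (candExp (.var 3)),
  .ite (.ilt (.var 18) (.var 16)) (block [.iset 16 (.var 18), .iset 17 (.var 3)]) .skip,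
  incr 3]

/-- Entry `i` of the enumeration is read as `(k, b, t)`, and the result belongs to row `k + 1`;
hence the write goes one full row, stored in variable `13`, beyond `i`. -/
def tablePost : Prog := block [
  .iset 18 (.read 5 (.var 2)),
  .iset 19 (.const 0),
  .ite (.and (.and (.not (.ilt (.read 4 (.var 6)) (.var 7))) (.ilt (.read 4 (.var 6)) (.var 8)))
      (.not (.and (.or (.ieq (.var 9) (.mod (.var 4) (.var 10)))
        (.ieq (.var 9) (.mod (.var 5) (.var 10)))) (.not (.ilt (.var 16) (.var 18))))))
    (block [.iset 18 (.var 16), .iset 19 (.add (.var 17) (.const 1))]) .skip,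
  .iwrite 5 (.add (.var 2) (.var 13)) (.var 18),
  .iwrite 6 (.add (.var 2) (.var 13)) (.var 19),
  incr 2]

def tableBody : Prog := .seq tablePre (.seq (.loop splitTest splitBody) tablePost)

/-- Invariant of the second phase after `i` entries. -/
structure TableInv (I : ColoredPoints n m) (ord yr ck : ℕ → ℕ) (S : ℕ → ℝ) (i : ℕ) (s : State) :
    Prop where
  fixed : Fixed I s
  sorted : HoldsSorted ord yr ck S s
  noLabels : NoLabels s
  counter : s.ivar 2 = i
  limit : s.ivar 12 = n * ((n + 1) * (m + 1)) * ((n + 1) * (m + 1))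
  row : s.ivar 13 = (n + 1) * (m + 1) * ((n + 1) * (m + 1))
  -- The offset of a full row is there because row `0` consists of zeros and is already present in
  -- the initial memory.
  value : ∀ j < (n + 1) * (m + 1) * ((n + 1) * (m + 1)) + i,
    s.imem 5 j = (cell ((n + 1) * (m + 1)) (m + 1) yr ck j).1
  choice : ∀ j < (n + 1) * (m + 1) * ((n + 1) * (m + 1)) + i,
    s.imem 6 j = (cell ((n + 1) * (m + 1)) (m + 1) yr ck j).2

theorem TableInv.congr {I : ColoredPoints n m} {ord yr ck : ℕ → ℕ} {S : ℕ → ℝ} {i : ℕ}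
    {s s' : State} (h : TableInv I ord yr ck S i s) (hf : Fixed I s')
    (hm : s'.imem = s.imem := by rfl) (hr : s'.rmem = s.rmem := by rfl)
    (h2 : s'.ivar 2 = s.ivar 2 := by simp) (h12 : s'.ivar 12 = s.ivar 12 := by simp)
    (h13 : s'.ivar 13 = s.ivar 13 := by simp) : TableInv I ord yr ck S i s' where
  fixed := hf
  sorted := h.sorted.congr (by rw [hm]) (by rw [hm]) (by rw [hm]) (by rw [hr])
  noLabels := h.noLabels.congr (by rw [hm]) (by rw [hm]) (by rw [hm]) (by rw [hr])
  counter := h2 ▸ h.counter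
  limit := h12 ▸ h.limit
  row := h13 ▸ h.row
  value := by rw [hm]; exact h.value
  choice := by rw [hm]; exact h.choice

theorem TableInv.next {I : ColoredPoints n m} {ord yr ck : ℕ → ℕ} {S : ℕ → ℝ} {i : ℕ}
    {s s' : State} (h : TableInv I ord yr ck S i s) (hf : Fixed I s')
    (h5 : s'.imem 5 = Function.update (s.imem 5) (i + (n + 1) * (m + 1) * ((n + 1) * (m + 1)))
      (cell ((n + 1) * (m + 1)) (m + 1) yr ck
        (i + (n + 1) * (m + 1) * ((n + 1) * (m + 1)))).1)
    (h6 : s'.imem 6 = Function.update (s.imem 6) (i + (n + 1) * (m + 1) * ((n + 1) * (m + 1)))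
      (cell ((n + 1) * (m + 1)) (m + 1) yr ck
        (i + (n + 1) * (m + 1) * ((n + 1) * (m + 1)))).2)
    (hs : HoldsSorted ord yr ck S s' := by exact h.sorted.congr)
    (hl : NoLabels s' := by exact h.noLabels.congr)
    (h2 : s'.ivar 2 = i + 1 := by simp) (h12 : s'.ivar 12 = s.ivar 12 := by simp)
    (h13 : s'.ivar 13 = s.ivar 13 := by simp) : TableInv I ord yr ck S (i + 1) s' where
  fixed := hf
  sorted := hs
  noLabels := hl
  counter := h2
  limit := h12 ▸ h.limit
  row := h13 ▸ h.row
  value j hj := by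
    rw [h5, Function.update_apply]
    split_ifs with hj'
    · rw [hj']
    · exact h.value j (by omega)
  choice j hj := by
    rw [h6, Function.update_apply]
    split_ifs with hj'
    · rw [hj']
    · exact h.choice j (by omega)

/-- The number of labels if the point with `k` points to its right starts a backbone in gap `g`. -/
def cand (m : ℕ) (yr ck : ℕ → ℕ) (k b t g : ℕ) : ℕ :=
  1 + (dp (m + 1) yr ck k b (g * (m + 1) + ck k)).1 +
    (dp (m + 1) yr ck k (g * (m + 1) + ck k) t).1

/-- The nested cases of `dp` merged into the single test of `tablePost`, which overwrites the
default only when a new backbone is opened. -/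
theorem dp_succ_eq (m : ℕ) (yr ck : ℕ → ℕ) (k b t : ℕ) :
    dp (m + 1) yr ck (k + 1) b t =
      if (b / (m + 1) ≤ yr k ∧ yr k < t / (m + 1)) ∧
          ¬ ((ck k = t % (m + 1) ∨ ck k = b % (m + 1)) ∧ (dp (m + 1) yr ck k b t).1 ≤
            (argScan (cand m yr ck k b t) (b / (m + 1)) (t / (m + 1) - b / (m + 1))).1) then
        ((argScan (cand m yr ck k b t) (b / (m + 1)) (t / (m + 1) - b / (m + 1))).1,
          (argScan (cand m yr ck k b t) (b / (m + 1)) (t / (m + 1) - b / (m + 1))).2 + 1)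
      else ((dp (m + 1) yr ck k b t).1, 0) := by
  rw [dp]
  by_cases h1 : b / (m + 1) ≤ yr k ∧ yr k < t / (m + 1)
  · simp only [h1, and_self, true_and, if_true]
    rw [ite_not]
    rfl
  · simp only [h1, false_and, if_false]

/-- The variables that describe the current entry `(k, b, t)`. -/
structure EntryVars (m : ℕ) (ck : ℕ → ℕ) (k b t : ℕ) (s : State) : Prop where
  top : s.ivar 4 = t
  bottom : s.ivar 5 = b
  point : s.ivar 6 = k
  bottomGap : s.ivar 7 = b / (m + 1)
  topGap : s.ivar 8 = t / (m + 1)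
  color : s.ivar 9 = ck k

theorem EntryVars.congr {ck : ℕ → ℕ} {k b t : ℕ} {s s' : State} (h : EntryVars m ck k b t s)
    (h4 : s'.ivar 4 = s.ivar 4 := by simp) (h5 : s'.ivar 5 = s.ivar 5 := by simp)
    (h6 : s'.ivar 6 = s.ivar 6 := by simp) (h7 : s'.ivar 7 = s.ivar 7 := by simp)
    (h8 : s'.ivar 8 = s.ivar 8 := by simp) (h9 : s'.ivar 9 = s.ivar 9 := by simp) :
    EntryVars m ck k b t s' :=
  ⟨h4 ▸ h.top, h5 ▸ h.bottom, h6 ▸ h.point, h7 ▸ h.bottomGap, h8 ▸ h.topGap, h9 ▸ h.color⟩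

/-- Sufficient word size. -/
def BigWord (n m W : ℕ) : Prop :=
  (n + 1) * ((n + 1) * (m + 1)) * ((n + 1) * (m + 1)) + 2 * n + m + 2 < W

theorem BigWord.code_lt (hW : BigWord n m W) : (n + 1) * (m + 1) < W := by
  have h1 : 1 ≤ (n + 1) * ((n + 1) * (m + 1)) := Nat.mul_pos (by omega) (by positivity)
  have := Nat.le_mul_of_pos_left ((n + 1) * (m + 1)) h1
  unfold BigWord at hW
  omega

theorem candExp_spec (hW : BigWord n m W) {I : ColoredPoints n m} {ord yr ck : ℕ → ℕ} {S : ℕ → ℝ}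
    (hS : IsSorted I ord yr ck S) {i k b t : ℕ} {s : State} (h : TableInv I ord yr ck S i s)
    (hv : EntryVars m ck k b t s) (hi : (k * ((n + 1) * (m + 1)) + b) * ((n + 1) * (m + 1)) + t = i)
    (hk : k < n) (hb : b < (n + 1) * (m + 1)) (ht : t < (n + 1) * (m + 1))
    {e : IExp} {g : ℕ} (he : e.Fits W s) (eg : e.eval s = g) (hg : g ≤ n) :
    (candExp e).Fits W s ∧ (candExp e).eval s = cand m yr ck k b t g := by
  have hc := hS.ck_lt hk
  have hgc := code_lt (m := m) hg hc.le
  have hN := hW.code_lt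
  have hW' := hW
  unfold BigWord at hW'
  have fc : (codeExp e).Fits W s ∧ (codeExp e).eval s = g * (m + 1) + ck k := by
    simp only [codeExp, IExp.Fits, IExp.eval, eg, h.fixed.colors, hv.color]
    exact ⟨⟨⟨he, by omega, by omega⟩, by omega, by omega⟩, trivial⟩
  have f1 := indexExp_spec (W := W) (s := s) (k := .var 6) (b := .var 5) (t := codeExp e)
    (k' := n + 1) (by omega) h.fixed.codes (by simp [hv.point]; omega) (by simp [hv.bottom]; omega)
    fc.1
    hv.point hv.bottom fc.2 (by omega) hb hgc
  have f2 := indexExp_spec (W := W) (s := s) (k := .var 6) (b := codeExp e) (t := .var 4)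
    (k' := n + 1) (by omega) h.fixed.codes (by simp [hv.point]; omega) fc.1 (by simp [hv.top]; omega)
    hv.point fc.2 hv.top (by omega) hgc ht
  -- Row `k` is complete by the time an entry of row `k + 1` is computed.
  have hi' : (k + 1) * ((n + 1) * (m + 1)) * ((n + 1) * (m + 1)) ≤
      (n + 1) * (m + 1) * ((n + 1) * (m + 1)) + i := by
    rw [← hi]
    nlinarith [Nat.zero_le (b * ((n + 1) * (m + 1)))]
  have v1 := h.value _ ((index_lt (Nat.lt_succ_self k) hb hgc).trans_le hi')
  have v2 := h.value _ ((index_lt (Nat.lt_succ_self k) hgc ht).trans_le hi')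
  rw [cell_index _ _ _ _ hb hgc] at v1
  rw [cell_index _ _ _ _ hgc ht] at v2
  have hck : ∀ j < k, ck j < m + 1 := fun j hj => (hS.ck_lt (hj.trans hk)).trans (by omega)
  have b1 := dp_le (yr := yr) (b := b) (t := g * (m + 1) + ck k) hck
  have b2 := dp_le (yr := yr) (b := g * (m + 1) + ck k) (t := t) hck
  simp only [candExp, IExp.Fits, IExp.eval, f1.2, f2.2, v1, v2, cand]
  exact ⟨⟨⟨by omega, ⟨f1.1, by omega⟩, by omega⟩, ⟨f2.1, by omega⟩, by omega⟩, trivial⟩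

/-- Invariant of the loop over the gaps after `d` rounds. -/
structure SplitInv (I : ColoredPoints n m) (ord yr ck : ℕ → ℕ) (S : ℕ → ℝ) (i k b t d : ℕ)
    (s : State) : Prop where
  table : TableInv I ord yr ck S i s
  vars : EntryVars m ck k b t s
  counter : s.ivar 3 = b / (m + 1) + d + 1
  best : s.ivar 16 = (argScan (cand m yr ck k b t) (b / (m + 1)) d).1
  arg : s.ivar 17 = (argScan (cand m yr ck k b t) (b / (m + 1)) d).2

/-- The bound is `1 + k + k` with `k < n`; it accounts for the summand `2 * n` in `BigWord`. -/
theorem cand_le {I : ColoredPoints n m} {ord yr ck : ℕ → ℕ} {S : ℕ → ℝ}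
    (hS : IsSorted I ord yr ck S) {k : ℕ} (hk : k < n) (b t g : ℕ) :
    cand m yr ck k b t g ≤ 2 * n := by
  have hck : ∀ j < k, ck j < m + 1 := fun j hj => (hS.ck_lt (hj.trans hk)).trans (by omega)
  have b1 := dp_le (yr := yr) (b := b) (t := g * (m + 1) + ck k) hck
  have b2 := dp_le (yr := yr) (b := g * (m + 1) + ck k) (t := t) hck
  unfold cand
  omega

theorem gap_le {b : ℕ} (hb : b < (n + 1) * (m + 1)) : b / (m + 1) ≤ n := by
  have := (Nat.div_lt_iff_lt_mul (by omega : 0 < m + 1)).2 hb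
  omega

section

variable (hW : BigWord n m W) {I : ColoredPoints n m} {ord yr ck : ℕ → ℕ} {S : ℕ → ℝ}
  (hS : IsSorted I ord yr ck S) {i k b t d : ℕ} {s : State}
  (hi : (k * ((n + 1) * (m + 1)) + b) * ((n + 1) * (m + 1)) + t = i)
  (hk : k < n) (hb : b < (n + 1) * (m + 1)) (ht : t < (n + 1) * (m + 1))

include hW hS hi hk hb ht

theorem splitBody_runs (hd : d < t / (m + 1) - b / (m + 1))
    (h : SplitInv I ord yr ck S i k b t d s) :
    Runs W splitBody s splitBody.time (SplitInv I ord yr ck S i k b t (d + 1)) := by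
  apply Runs.of_wp
  have hgt := gap_le ht
  have hW' := hW
  unfold BigWord at hW'
  have hc := candExp_spec hW hS h.table h.vars hi hk hb ht (e := .var 3)
    (g := b / (m + 1) + d + 1) (by simp only [IExp.Fits, h.counter]; omega) h.counter (by omega)
  have c1 := cand_le (m := m) hS hk b t (b / (m + 1) + d + 1)
  have c2 := cand_le (m := m) hS hk b t (argScan (cand m yr ck k b t) (b / (m + 1)) d).2
  rw [← (argScan_spec (cand m yr ck k b t) _ _).1] at c2
  simp [splitBody, hc.1, hc.2, h.best, h.counter]
  repeat' apply And.intro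
  all_goals try omega
  · intro hlt
    repeat' apply And.intro
    all_goals try omega
    refine ⟨h.table.congr h.table.fixed.congr, h.vars.congr, by simp; omega, ?_, ?_⟩
    all_goals
      rw [argScan, if_pos hlt]
      simp
  · intro hlt
    repeat' apply And.intro
    all_goals try omega
    refine ⟨h.table.congr h.table.fixed.congr, h.vars.congr, by simp; omega, ?_, ?_⟩
    all_goals
      rw [argScan, if_neg (by omega)]
      simp [h.best, h.arg]

theorem startSplit_wp (h : TableInv I ord yr ck S i s) (hv : EntryVars m ck k b t s) :
    startSplit.wp W (SplitInv I ord yr ck S i k b t 0) s := by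
  have hgb := gap_le hb
  have hW' := hW
  unfold BigWord at hW'
  have hc := candExp_spec hW hS h hv hi hk hb ht (e := .var 7)
    (g := b / (m + 1)) (by simp only [IExp.Fits, hv.bottomGap]; omega) hv.bottomGap hgb
  simp [startSplit, hc.1, hc.2, hv.bottomGap]
  repeat' apply And.intro
  all_goals try omega
  exact ⟨h.congr h.fixed.congr, hv.congr, by simp, by simp [argScan], by simp [argScan]⟩

theorem decode_wp (h : TableInv I ord yr ck S i s) :
    decode.wp W (fun s => TableInv I ord yr ck S i s ∧ EntryVars m ck k b t s) s := by
  have hN := hW.code_lt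
  have hgb := gap_le hb
  have hgt := gap_le ht
  have hck := hS.ck_lt hk
  have hW' := hW
  unfold BigWord at hW'
  have et : i % ((n + 1) * (m + 1)) = t := by rw [← hi, code_mod ht]
  have ed : i / ((n + 1) * (m + 1)) = k * ((n + 1) * (m + 1)) + b := by rw [← hi, code_div ht]
  have hil : i < W := by
    have := index_lt (show k < n + 1 by omega) hb ht
    omega
  have hdl : k * ((n + 1) * (m + 1)) + b < W := ed ▸ (Nat.div_le_self _ _).trans_lt hil
  simp [decode, h.counter, h.fixed.codes, h.fixed.colors, et, ed, code_mod hb, code_div hb,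
    h.sorted.ck]
  repeat' apply And.intro
  all_goals try omega
  · exact h.congr h.fixed.congr
  · exact ⟨by simp, by simp, by simp, by simp, by simp, by simp⟩

theorem tablePost_wp (h : SplitInv I ord yr ck S i k b t (t / (m + 1) - b / (m + 1)) s) :
    tablePost.wp W (TableInv I ord yr ck S (i + 1)) s := by
  obtain ⟨h, hv, h3, h16, h17⟩ := h
  have hN := hW.code_lt
  have hgb := gap_le hb
  have hgt := gap_le ht
  have hck := hS.ck_lt hk
  have hyr := hS.yr_lt hk
  have hW' := hW
  unfold BigWord at hW'
  have hnext : i + (n + 1) * (m + 1) * ((n + 1) * (m + 1)) =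
      ((k + 1) * ((n + 1) * (m + 1)) + b) * ((n + 1) * (m + 1)) + t := by
    rw [← hi]
    ring
  have hlt := index_lt (show k + 1 < n + 1 by omega) hb ht
  rw [← hnext] at hlt
  have hNN : 1 ≤ (n + 1) * (m + 1) * ((n + 1) * (m + 1)) := Nat.succ_le_of_lt (by positivity)
  have hsame := h.value i (by omega)
  have hcell := cell_index (m + 1) yr ck (k + 1) hb ht
  rw [← hnext] at hcell
  rw [← hi, cell_index _ _ _ _ hb ht, hi] at hsame
  have bsame := dp_le (M := m + 1) (yr := yr) (ck := ck) (k := k) (b := b) (t := t)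
    fun j hj => (hS.ck_lt (hj.trans hk)).trans (by omega)
  obtain ⟨a1, a2, a3⟩ := argScan_spec (cand m yr ck k b t) (b / (m + 1))
    (t / (m + 1) - b / (m + 1))
  have a4 := cand_le (m := m) hS hk b t
    (argScan (cand m yr ck k b t) (b / (m + 1)) (t / (m + 1) - b / (m + 1))).2
  rw [← a1] at a4
  have hdp := dp_succ_eq m yr ck k b t
  simp only [tablePost, block, incr, Prog.wp, IExp.Fits, IExp.eval, Test.Fits, Test.Holds,
    State.setI_ivar, State.setI_imem, State.writeI_ivar, h.counter, h.row,
    h.fixed.colors, h.sorted.yr, hv.top, hv.bottom, hv.point, hv.bottomGap, hv.topGap, hv.color,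
    h16, h17, hsame, if_true, if_false, Nat.reduceEqDiff, Nat.succ_ne_self, not_lt]
  generalize argScan (cand m yr ck k b t) (b / (m + 1)) (t / (m + 1) - b / (m + 1)) = r at *
  repeat' apply And.intro
  all_goals try omega
  · intro hcond
    rw [if_pos hcond, ← hcell] at hdp
    repeat' apply And.intro
    all_goals try omega
    exact h.next h.fixed.congr (by simp [hdp]) (by simp [hdp])
  · intro hcond
    rw [if_neg hcond, ← hcell] at hdp
    repeat' apply And.intro
    all_goals try omega
    exact h.next h.fixed.congr (by simp [hdp]) (by simp [hdp])

theorem tableBody_runs (h : TableInv I ord yr ck S i s) :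
    Runs W tableBody s (tablePre.time +
      ((t / (m + 1) - b / (m + 1)) * (splitTest.cost + splitBody.time + 1) +
        (splitTest.cost + 1) + tablePost.time)) (TableInv I ord yr ck S (i + 1)) := by
  have hgt := gap_le ht
  have hgb := gap_le hb
  have hW' := hW
  unfold BigWord at hW'
  have hfit : ∀ d s, d ≤ t / (m + 1) - b / (m + 1) → SplitInv I ord yr ck S i k b t d s →
      splitTest.Fits W s ∧ (splitTest.Holds s ↔ b / (m + 1) + d + 1 < t / (m + 1) + 1) := by
    intro d s hd h
    simp only [splitTest, Test.Fits, IExp.Fits, IExp.eval, Test.Holds, h.counter, h.vars.topGap,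
      and_true]
    omega
  -- The number of rounds is the truncated difference of the gaps. It is `0` for pairs whose top is
  -- below their bottom, and such entries are computed all the same.
  refine Runs.seq_loop_seq (SplitInv I ord yr ck S i k b t) _ _ ?_ ?_ ?_
  · exact (decode_wp hW hS hi hk hb ht h).mono fun s hs =>
      startSplit_wp hW hS hi hk hb ht hs.1 hs.2
  · intro d hd s h
    exact ⟨(hfit d s hd.le h).1, (hfit d s hd.le h).2.2 (by omega),
      splitBody_runs hW hS hi hk hb ht hd h⟩
  · intro s h
    refine ⟨(hfit _ s le_rfl h).1, ?_, tablePost_wp hW hS hi hk hb ht h⟩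
    rw [(hfit _ s le_rfl h).2]
    omega

end

/-- Time for one entry of the table. -/
def entryTime (n : ℕ) : ℕ :=
  tablePre.time + (n * (splitTest.cost + splitBody.time + 1) + (splitTest.cost + 1) +
    tablePost.time)

theorem tableBody_runs_of_lt (hW : BigWord n m W) {I : ColoredPoints n m} {ord yr ck : ℕ → ℕ}
    {S : ℕ → ℝ} (hS : IsSorted I ord yr ck S) {i : ℕ} {s : State}
    (hi : i < n * ((n + 1) * (m + 1)) * ((n + 1) * (m + 1)))
    (h : TableInv I ord yr ck S i s) :
    Runs W tableBody s (entryTime n) (TableInv I ord yr ck S (i + 1)) := by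
  set N := (n + 1) * (m + 1) with hN
  have hN0 : 0 < N := by positivity
  have ht := Nat.mod_lt i hN0
  refine (tableBody_runs hW hS (k := i / N / N) (b := i / N % N) (t := i % N) ?_ ?_
    (Nat.mod_lt _ hN0) ht h).mono ?_ fun _ h => h
  · rw [← hN, Nat.div_add_mod', Nat.div_add_mod']
  · rw [Nat.div_lt_iff_lt_mul hN0, Nat.div_lt_iff_lt_mul hN0]
    exact hi
  · have h1 : i % N / (m + 1) - i / N % N / (m + 1) ≤ n := (Nat.sub_le _ _).trans (gap_le ht)
    have h2 := Nat.mul_le_mul_right (splitTest.cost + splitBody.time + 1) h1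
    unfold entryTime
    omega

/-! #### Constructing the labels -/

def locate : Prog := block [
  .iset 6 (.sub (.sub (.var 0) (.const 1)) (.var 2)),
  .iset 4 (.read 3 (.var 6)),
  .iset 9 (.read 8 (.var 6)),
  .rset 4 (.read 1 (.var 4)),
  .rset 5 (.var 2),
  .rset 6 (.var 3),
  .iset 5 (.var 1),
  .iset 7 (.add (.mul (.var 0) (.var 10)) (.var 1)),
  .iset 8 (.const 0),
  .iset 14 (.const 0),
  .iset 3 (.const 0)]

def scanTest : Test := .ilt (.var 3) (.var 20)

def scanLower : Prog := .ite (.and (.rlt (.var 7) (.var 4)) (.rlt (.var 5) (.var 7)))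
  (block [.rset 5 (.var 7), .iset 5 (.read 7 (.var 3)), .iset 8 (.var 3)]) .skip

def scanUpper : Prog := .ite (.and (.rlt (.var 4) (.var 7)) (.rlt (.var 7) (.var 6)))
  (block [.rset 6 (.var 7), .iset 7 (.read 7 (.var 3)), .iset 14 (.var 3)]) .skip

def scanBody : Prog := block [.rset 7 (.read 2 (.var 3)), scanLower, scanUpper, incr 3]

def readChoice : Prog :=
  .iset 15 (.read 6 (indexExp (.add (.var 6) (.const 1)) (.var 5) (.var 7)))

def connectPart : Prog := .ite (.ieq (.var 9) (.mod (.var 7) (.var 10)))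
  (.iwrite 1 (.var 4) (.var 14)) (.iwrite 1 (.var 4) (.var 8))

def boundsPart : Prog := block [
  .iset 15 (.sub (.var 15) (.const 1)),
  .rset 7 (.read 3 (.var 15)),
  .ite (.rlt (.var 7) (.var 5)) (.rset 7 (.var 5)) .skip,
  .rset 8 (.read 3 (.add (.var 15) (.const 1))),
  .ite (.rlt (.var 6) (.var 8)) (.rset 8 (.var 6)) .skip]

def addPart : Prog := block [
  .rwrite 2 (.var 20) (.div (.add (.var 7) (.var 8)) (.const 2)),
  .iwrite 7 (.var 20) (codeExp (.var 15)),
  .iwrite 2 (.var 20) (.var 9),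
  .iwrite 1 (.var 4) (.var 20),
  incr 20]

def sweepPost : Prog := block [
  readChoice,
  .ite (.ieq (.var 15) (.const 0)) connectPart (.seq boundsPart addPart),
  incr 2]

def sweepBody : Prog := .seq locate (.seq (.loop scanTest scanBody) sweepPost)

/-- The memory holds the table of choices and the state `st` of the sweep after `j` points. -/
structure SweepMem (I : ColoredPoints n m) (ord yr ck : ℕ → ℕ) (S : ℕ → ℝ) (j : ℕ) (st : Sweep)
    (s : State) : Prop where
  fixed : Fixed I s
  sorted : HoldsSorted ord yr ck S s
  choice : ∀ k ≤ n, ∀ b < (n + 1) * (m + 1), ∀ t < (n + 1) * (m + 1),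
    s.imem 6 ((k * ((n + 1) * (m + 1)) + b) * ((n + 1) * (m + 1)) + t) =
      (dp (m + 1) yr ck k b t).2
  counter : s.ivar 2 = j
  cnt : s.ivar 20 = st.cnt
  height : s.rmem 2 = st.height
  code : s.imem 7 = st.code
  color : s.imem 2 = st.color
  assign : s.imem 1 = st.assign

theorem SweepMem.congr {I : ColoredPoints n m} {ord yr ck : ℕ → ℕ} {S : ℕ → ℝ} {j : ℕ} {st : Sweep}
    {s s' : State} (h : SweepMem I ord yr ck S j st s) (hf : Fixed I s')
    (hm : s'.imem = s.imem := by rfl) (hr : s'.rmem = s.rmem := by rfl)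
    (h2 : s'.ivar 2 = s.ivar 2 := by simp) (h20 : s'.ivar 20 = s.ivar 20 := by simp) :
    SweepMem I ord yr ck S j st s' where
  fixed := hf
  sorted := h.sorted.congr (by rw [hm]) (by rw [hm]) (by rw [hm]) (by rw [hr])
  choice := by rw [hm]; exact h.choice
  counter := h2 ▸ h.counter
  cnt := h20 ▸ h.cnt
  height := by rw [hr, h.height]
  code := by rw [hm, h.code]
  color := by rw [hm, h.color]
  assign := by rw [hm, h.assign]

/-- The variables that describe the point that is processed. -/
structure PointVars (I : ColoredPoints n m) (ord ck : ℕ → ℕ) (k : ℕ) (s : State) : Prop where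
  rank : s.ivar 6 = k
  point : s.ivar 4 = ord k
  color : s.ivar 9 = ck k
  py : s.rvar 4 = I.py (ord k)

theorem PointVars.congr {I : ColoredPoints n m} {ord ck : ℕ → ℕ} {k : ℕ} {s s' : State}
    (h : PointVars I ord ck k s) (h6 : s'.ivar 6 = s.ivar 6 := by simp)
    (h4 : s'.ivar 4 = s.ivar 4 := by simp) (h9 : s'.ivar 9 = s.ivar 9 := by simp)
    (r4 : s'.rvar 4 = s.rvar 4 := by simp) : PointVars I ord ck k s' :=
  ⟨h6 ▸ h.rank, h4 ▸ h.point, h9 ▸ h.color, r4 ▸ h.py⟩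

structure LowerVars (q : ℝ × ℕ × ℕ) (s : State) : Prop where
  height : s.rvar 5 = q.1
  code : s.ivar 5 = q.2.1
  index : s.ivar 8 = q.2.2

theorem LowerVars.congr {q : ℝ × ℕ × ℕ} {s s' : State} (h : LowerVars q s)
    (r5 : s'.rvar 5 = s.rvar 5 := by simp) (h5 : s'.ivar 5 = s.ivar 5 := by simp)
    (h8 : s'.ivar 8 = s.ivar 8 := by simp) : LowerVars q s' :=
  ⟨r5 ▸ h.height, h5 ▸ h.code, h8 ▸ h.index⟩

structure UpperVars (q : ℝ × ℕ × ℕ) (s : State) : Prop where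
  height : s.rvar 6 = q.1
  code : s.ivar 7 = q.2.1
  index : s.ivar 14 = q.2.2

theorem UpperVars.congr {q : ℝ × ℕ × ℕ} {s s' : State} (h : UpperVars q s)
    (r6 : s'.rvar 6 = s.rvar 6 := by simp) (h7 : s'.ivar 7 = s.ivar 7 := by simp)
    (h14 : s'.ivar 14 = s.ivar 14 := by simp) : UpperVars q s' :=
  ⟨r6 ▸ h.height, h7 ▸ h.code, h14 ▸ h.index⟩

/-- Invariant of the scan for the neighbors of the current point after `l` labels. -/
structure ScanInv (I : ColoredPoints n m) (ord yr ck : ℕ → ℕ) (S : ℕ → ℝ) (j : ℕ) (st : Sweep)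
    (k l : ℕ) (s : State) : Prop where
  mem : SweepMem I ord yr ck S j st s
  vars : PointVars I ord ck k s
  counter : s.ivar 3 = l
  lower : LowerVars (nearest (· < ·) st.height st.code (I.py (ord k)) I.ymin m l) s
  upper : UpperVars
    (nearest (· > ·) st.height st.code (I.py (ord k)) I.ymax (n * (m + 1) + m) l) s

theorem nearest_index_le (r : ℝ → ℝ → Prop) (height : ℕ → ℝ) (code : ℕ → ℕ) (y h₀ : ℝ)
    (c₀ cnt : ℕ) :
    (nearest r height code y h₀ c₀ cnt).2.2 ≤ cnt := by
  induction cnt with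
  | zero => simp [nearest]
  | succ l ih =>
    rw [nearest]
    split_ifs
    · simp
    · exact ih.trans (by omega)

section

variable {I : ColoredPoints n m} {ord yr ck : ℕ → ℕ} {S : ℕ → ℝ} {st : Sweep} {j k l : ℕ}
  {s : State}

theorem Sweep.Valid.code_lt (hst : Sweep.Valid I ord ck S k st) (hl : l < st.cnt) :
    st.code l < (n + 1) * (m + 1) := by
  obtain ⟨g, h1, h2, h3, -⟩ := hst.label l hl
  rw [h2]
  exact Backbone.code_lt h1 h3.le

theorem Sweep.IsLow.code_lt (hst : Sweep.Valid I ord ck S k st) {h : ℝ} {c : ℕ}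
    (hh : st.IsLow I h c) : c < (n + 1) * (m + 1) := by
  rcases hh with ⟨-, rfl⟩ | ⟨l, hl, -, rfl⟩
  · have := Backbone.code_lt (Nat.zero_le n) (le_refl c)
    omega
  · exact hst.code_lt hl

theorem Sweep.IsHigh.code_lt (hst : Sweep.Valid I ord ck S k st) {h : ℝ} {c : ℕ}
    (hh : st.IsHigh I h c) : c < (n + 1) * (m + 1) := by
  rcases hh with ⟨-, rfl⟩ | ⟨l, hl, -, rfl⟩
  · exact Backbone.code_lt le_rfl le_rfl
  · exact hst.code_lt hl

theorem locate_wp (hW : BigWord n m W) (hS : IsSorted I ord yr ck S) (hjk : j + k + 1 = n)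
    (h : SweepMem I ord yr ck S j st s) : locate.wp W (ScanInv I ord yr ck S j st k 0) s := by
  have hk : k < n := by omega
  have hN := hW.code_lt
  have h1 := Backbone.code_lt (le_refl n) (le_refl m)
  have h2 := hS.ck_lt hk
  have h3 := hS.ord_lt hk
  have hW' := hW
  unfold BigWord at hW'
  -- The sweep counts the processed points from the left, ranks count from the right.
  have ek : n - 1 - j = k := by omega
  simp [locate, h.fixed.size, h.fixed.numColors, h.fixed.colors, h.counter, h.sorted.ord,
    h.sorted.ck, h.fixed.py, h.fixed.ymin, h.fixed.ymax, ek]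
  repeat' apply And.intro
  all_goals try omega
  exact ⟨h.congr h.fixed.congr, ⟨by simp, by simp, by simp, by simp⟩, by simp,
    ⟨by simp [nearest], by simp [nearest], by simp [nearest]⟩,
    ⟨by simp [nearest], by simp [nearest], by simp [nearest]⟩⟩

theorem scanBody_runs (hW : BigWord n m W) (hst : Sweep.Valid I ord ck S (k + 1) st)
    (hl : l < st.cnt) (h : ScanInv I ord yr ck S j st k l s) :
    Runs W scanBody s scanBody.time (ScanInv I ord yr ck S j st k (l + 1)) := by
  apply Runs.of_wp
  have hN := hW.code_lt
  have hcode := hst.code_lt hl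
  have hcnt := hst.cnt_le
  have hW' := hW
  unfold BigWord at hW'
  have elo := h.lower.height
  have ehi := h.upper.height
  simp only [scanBody, scanLower, scanUpper, block, incr, Prog.wp, IExp.Fits, IExp.eval, RExp.Fits,
    RExp.eval, Test.Fits, Test.Holds, State.setI_ivar, State.setI_imem, State.setR_ivar,
    State.setI_rvar, State.setR_imem, State.setR_rvar, h.mem.height, h.mem.code, h.counter, elo,
    ehi, h.vars.py, if_true, if_false, Nat.reduceEqDiff, Nat.succ_ne_self, and_self, true_and]
  repeat' first | apply And.intro | intro _
  all_goals try omega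
  all_goals
    rename_i c1 c2
    refine ⟨h.mem.congr h.mem.fixed.congr, h.vars.congr, by simp, ?_, ?_⟩
  · rw [nearest, if_pos c1]
    exact ⟨by simp, by simp, by simp⟩
  · rw [nearest, if_pos c2]
    exact ⟨by simp, by simp, by simp⟩
  · rw [nearest, if_pos c1]
    exact ⟨by simp, by simp, by simp⟩
  · rw [nearest, if_neg c2]
    exact h.upper.congr
  · rw [nearest, if_neg c1]
    exact h.lower.congr
  · rw [nearest, if_pos c2]
    exact ⟨by simp, by simp, by simp⟩
  · rw [nearest, if_neg c1]
    exact h.lower.congr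
  · rw [nearest, if_neg c2]
    exact h.upper.congr

/-- Stated for an arbitrary postcondition, so that the four branches of computing a maximum and a
minimum are hidden from the code that follows. -/
theorem boundsPart_wp (hfit : s.ivar 15 < W) (hone : 1 < W) (hfit' : s.ivar 15 - 1 + 1 < W)
    (hS' : s.rmem 3 = S) {Q : State → Prop}
    (hQ : ∀ s' : State, (∀ v, v ≠ 15 → s'.ivar v = s.ivar v) → s'.ivar 15 = s.ivar 15 - 1 →
      s'.imem = s.imem → s'.rmem = s.rmem → (∀ v, v ≠ 7 → v ≠ 8 → s'.rvar v = s.rvar v) →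
      s'.rvar 7 = max (s.rvar 5) (S (s.ivar 15 - 1)) →
      s'.rvar 8 = min (s.rvar 6) (S (s.ivar 15 - 1 + 1)) → Q s') :
    boundsPart.wp W Q s := by
  simp only [boundsPart, block, Prog.wp, IExp.Fits, IExp.eval, RExp.Fits,
    RExp.eval, Test.Fits, Test.Holds, State.setI_ivar, State.setR_ivar,
    State.setI_rvar, State.setR_rvar, State.setI_rmem, State.setR_rmem, hS',
    if_true, if_false, Nat.reduceEqDiff, Nat.succ_ne_self, and_self, true_and]
  repeat' first | apply And.intro | intro _
  all_goals try omega
  all_goals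
    rename_i c1 c2
    refine hQ _ (fun v hv => by simp [hv]) (by simp) rfl rfl
      (fun v hv hv' => by simp [hv, hv']) ?_ ?_
  · simp [max_eq_left c1.le]
  · simp [min_eq_left c2.le]
  · simp [max_eq_left c1.le]
  · simp [min_eq_right (not_lt.1 c2)]
  · simp [max_eq_right (not_lt.1 c1)]
  · simp [min_eq_left c2.le]
  · simp [max_eq_right (not_lt.1 c1)]
  · simp [min_eq_right (not_lt.1 c2)]

theorem sweepPost_wp (hW : BigWord n m W) (hS : IsSorted I ord yr ck S) (hjk : j + k + 1 = n)
    (hst : Sweep.Valid I ord ck S (k + 1) st) (h : ScanInv I ord yr ck S j st k st.cnt s) :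
    sweepPost.wp W (SweepMem I ord yr ck S (j + 1) (Sweep.step I ord yr ck S k st)) s := by
  have hcnt := hst.cnt_le
  have hk : k < n := by omega
  have hn : 0 < n := by omega
  obtain ⟨h, hv, h3, hlo, hhi⟩ := h
  have lidx := nearest_index_le (· < ·) st.height st.code (I.py (ord k)) I.ymin m st.cnt
  have hidx := nearest_index_le (· > ·) st.height st.code (I.py (ord k)) I.ymax (n * (m + 1) + m)
    st.cnt
  rw [← Sweep.lower] at hlo lidx
  rw [← Sweep.upper] at hhi hidx
  have clo := (Sweep.lower_spec hS hst hk).1.code_lt hst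
  have chi := (Sweep.upper_spec hS hst hk).1.code_lt hst
  have hN := hW.code_lt
  have hck := hS.ck_lt hk
  have hord := hS.ord_lt hk
  have hgap := gap_le chi
  have hch := dp_choice_le (M := m + 1) (yr := yr) (ck := ck) (k := k + 1)
    (b := (Sweep.lower I ord k st).2.1) (t := (Sweep.upper I ord k st).2.1)
  have hcell := h.choice (k + 1) hk _ clo _ chi
  have hgcode := Backbone.code_lt (m := m) (n := n) (g := (dp (m + 1) yr ck (k + 1)
    (Sweep.lower I ord k st).2.1 (Sweep.upper I ord k st).2.1).2 - 1) (by omega) hck.le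
  have hstep := (rfl : Sweep.step I ord yr ck S k st = _)
  conv at hstep => rhs; rw [Sweep.step]
  generalize Sweep.lower I ord k st = lo at *
  generalize Sweep.upper I ord k st = hi at *
  generalize hchd : (dp (m + 1) yr ck (k + 1) lo.2.1 hi.2.1).2 = ch at *
  have hW' := hW
  unfold BigWord at hW'
  have hidxE := indexExp_spec (W := W) (s := s) (k := .add (.var 6) (.const 1)) (b := .var 5)
    (t := .var 7) (k' := n + 1) (by omega) h.fixed.codes (by simp [hv.rank]; omega)
    (by simp [hlo.code]; omega) (by simp [hhi.code]; omega) (by simp [hv.rank]; rfl) hlo.code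
    hhi.code (by omega) clo chi
  simp only [sweepPost, readChoice, block, Prog.wp, IExp.Fits, IExp.eval, Test.Fits, Test.Holds,
    State.setI_ivar, if_true, hidxE.2, hcell]
  refine ⟨⟨hidxE.1, by omega⟩, ⟨by omega, by omega⟩, fun hz => ?_, fun hz => ?_⟩
  · rw [hstep, if_pos hz]
    simp only [connectPart, incr, Prog.wp, IExp.Fits, IExp.eval, Test.Fits, Test.Holds,
      State.setI_ivar, if_false, Nat.reduceEqDiff, hv.color, hhi.code, h.fixed.colors, hv.point,
      hhi.index, hlo.index, State.writeI_ivar, h.counter]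
    repeat' first | apply And.intro | intro _
    all_goals try omega
    all_goals
      rename_i c1
      refine ⟨h.fixed.congr, h.sorted.congr, by simpa using h.choice, by simp,
        by simpa [Sweep.connect] using h.cnt, by simpa [Sweep.connect] using h.height,
        by simpa [Sweep.connect] using h.code, by simpa [Sweep.connect] using h.color, ?_⟩
      simp [Sweep.connect, c1, h.assign]
  · rw [hstep, if_neg hz]
    apply boundsPart_wp (S := S)
    · simp; omega
    · omega
    · simp; omega
    · simpa using h.sorted.S
    · intro s' e1 e2 e3 e4 e5 e6 e7
      simp only [State.setI_ivar, if_true, State.setI_imem, State.setI_rvar, State.setI_rmem,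
        hlo.height, hhi.height] at e1 e2 e3 e4 e5 e6 e7
      have f2 : s'.ivar 2 = j := by simpa [h.counter] using e1 2 (by simp)
      have f4 : s'.ivar 4 = ord k := by simpa [hv.point] using e1 4 (by simp)
      have f9 : s'.ivar 9 = ck k := by simpa [hv.color] using e1 9 (by simp)
      have f10 : s'.ivar 10 = m + 1 := by simpa [h.fixed.colors] using e1 10 (by simp)
      have f20 : s'.ivar 20 = st.cnt := by simpa [h.cnt] using e1 20 (by simp)
      have hf : Fixed I s' := h.fixed.congr (by simpa using e1 0 (by simp))
        (by simpa using e1 1 (by simp)) (by simpa using e1 10 (by simp))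
        (by simpa using e1 11 (by simp)) (e5 2 (by simp) (by simp)) (e5 3 (by simp) (by simp))
        (by rw [e4]) (by rw [e4])
      have hs : HoldsSorted ord yr ck S s' :=
        h.sorted.congr (by rw [e3]) (by rw [e3]) (by rw [e3]) (by rw [e4])
      simp only [addPart, codeExp, block, incr, Prog.wp, IExp.Fits, IExp.eval, RExp.Fits, RExp.eval,
        State.setI_ivar, State.writeI_ivar, State.writeR_ivar, f2, f4, f9, f10, f20, e2, e6, e7,
        if_false, Nat.reduceEqDiff]
      repeat' apply And.intro
      all_goals try trivial
      all_goals try omega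
      · norm_num
      · refine ⟨hf.congr, hs.congr, by simpa [e3] using h.choice, by simp, by simp [Sweep.addLabel],
          ?_, ?_, ?_, ?_⟩
        · simp [Sweep.addLabel, e4, h.height]
        · simp [Sweep.addLabel, e3, h.code]
        · simp [Sweep.addLabel, e3, h.color]
        · simp [Sweep.addLabel, e3, h.assign]

/-- Time for one round of the sweep. -/
def sweepTime (n : ℕ) : ℕ :=
  locate.time + (n * (scanTest.cost + scanBody.time + 1) + (scanTest.cost + 1) + sweepPost.time)

theorem sweepBody_runs (hW : BigWord n m W) (hS : IsSorted I ord yr ck S) (hjk : j + k + 1 = n)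
    (hst : Sweep.Valid I ord ck S (k + 1) st) (h : SweepMem I ord yr ck S j st s) :
    Runs W sweepBody s (sweepTime n)
      (SweepMem I ord yr ck S (j + 1) (Sweep.step I ord yr ck S k st)) := by
  have hcnt := hst.cnt_le
  have hW' := hW
  unfold BigWord at hW'
  refine (Runs.seq_loop_seq (ScanInv I ord yr ck S j st k) st.cnt scanBody.time
    (locate_wp hW hS hjk h) (fun l hl s h => ?_) fun s h => ?_).mono ?_ fun _ h => h
  · refine ⟨?_, ?_, scanBody_runs hW hst hl h⟩
    · simp only [scanTest, Test.Fits, IExp.Fits, h.counter, h.mem.cnt]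
      omega
    · simpa only [scanTest, Test.Holds, IExp.eval, h.counter, h.mem.cnt] using hl
  · refine ⟨?_, ?_, sweepPost_wp hW hS hjk hst h⟩
    · simp only [scanTest, Test.Fits, IExp.Fits, h.counter, h.mem.cnt]
      omega
    · simp only [scanTest, Test.Holds, IExp.eval, h.counter, h.mem.cnt]
      omega
  · have := Nat.mul_le_mul_right (scanTest.cost + scanBody.time + 1) (show st.cnt ≤ n by omega)
    unfold sweepTime
    omega

end

/-! #### The complete algorithm -/

theorem Sweep.Valid.step {I : ColoredPoints n m} {ord yr ck : ℕ → ℕ} {S : ℕ → ℝ} {st : Sweep}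
    {k : ℕ} (hS : IsSorted I ord yr ck S) (hst : Sweep.Valid I ord ck S (k + 1) st) :
    Sweep.Valid I ord ck S k (Sweep.step I ord yr ck S k st) := by
  obtain ⟨lo, clo, hi, chi, hadj, h1, h2, ⟨l, hl, hstep, hc, hh, -⟩ |
    ⟨h, g, hg, hstep, h3, h4, h5, h6, -⟩⟩ := Sweep.step_spec hS hst
  · rw [hstep]
    exact hst.connect hS hadj h1 h2 hl hc hh
  · rw [hstep]
    exact hst.addLabel hS hadj h1 h2 hg h3 h4 h5 h6

/-- Straight-line code followed by a loop. -/
theorem Runs.seq_loop {p body : Prog} {b : Test} {s : State} {Q : State → Prop}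
    (Inv : ℕ → State → Prop) (N T : ℕ) (h0 : p.wp W (Inv 0) s)
    (hstep : ∀ j < N, ∀ s, Inv j s →
      b.Fits W s ∧ b.Holds s ∧ Runs W body s T (Inv (j + 1)))
    (hdone : ∀ s, Inv N s → b.Fits W s ∧ ¬ b.Holds s ∧ Q s) :
    Runs W (.seq p (.loop b body)) s (p.time + (N * (b.cost + T + 1) + (b.cost + 1))) Q :=
  .seq ((of_wp h0).mono le_rfl fun _ h => .loop Inv N T h hstep hdone)

def pointTest : Test := .ilt (.var 2) (.var 0)

def entryTest : Test := .ilt (.var 2) (.var 12)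

def sortPhase : Prog := .seq initPart (.loop pointTest sortBody)

def startTable : Prog := block [
  .iset 12 (.mul (.mul (.var 0) (.var 11)) (.var 11)),
  .iset 13 (.mul (.var 11) (.var 11)),
  .iset 2 (.const 0)]

def tablePhase : Prog := .seq startTable (.loop entryTest tableBody)

def startSweep : Prog := block [.iset 20 (.const 0), .iset 2 (.const 0)]

def sweepPhase : Prog := .seq startSweep (.loop pointTest sweepBody)

/-- The program for backbone labelings with the minimum number of finite backbones. -/
def labelProg : Prog := block [sortPhase, tablePhase, sweepPhase, .iset 0 (.var 20)]

theorem sortPhase_runs (hW : BigWord n m W) (I : ColoredPoints n m) :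
    Runs W sortPhase (inputState I)
      (initPart.time + (n * (pointTest.cost + sortTime n + 1) + (pointTest.cost + 1)))
      (SortInv I n) := by
  have hN := hW.code_lt
  have hW' : n + m + 2 < W := by
    unfold BigWord at hW
    omega
  refine Runs.seq_loop (SortInv I) n _ (initPart_wp hW' hN I) (fun i hi s h => ?_) fun s h => ?_
  · refine ⟨?_, ?_, sortBody_runs hW' hi h⟩
    · simp only [pointTest, Test.Fits, IExp.Fits, h.counter, h.fixed.size]
      omega
    · simpa only [pointTest, Test.Holds, IExp.eval, h.counter, h.fixed.size] using hi
  · refine ⟨?_, ?_, h⟩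
    · simp only [pointTest, Test.Fits, IExp.Fits, h.counter, h.fixed.size]
      omega
    · simp only [pointTest, Test.Holds, IExp.eval, h.counter, h.fixed.size, lt_irrefl,
        not_false_eq_true]

theorem SortInv.isSorted {I : ColoredPoints n m} {s : State} (h : SortInv I n s) :
    IsSorted I (s.imem 3) (s.imem 4) (s.imem 8) (s.rmem 3) :=
  ⟨h.ord, h.yr, h.ck, h.S, h.S_zero, h.S_last⟩

theorem tablePhase_runs (hW : BigWord n m W) {I : ColoredPoints n m} {s : State}
    (h : SortInv I n s) :
    Runs W tablePhase s
      (startTable.time + (n * ((n + 1) * (m + 1)) * ((n + 1) * (m + 1)) *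
        (entryTest.cost + entryTime n + 1) + (entryTest.cost + 1)))
      (TableInv I (s.imem 3) (s.imem 4) (s.imem 8) (s.rmem 3)
        (n * ((n + 1) * (m + 1)) * ((n + 1) * (m + 1)))) := by
  have hN := hW.code_lt
  have hS := h.isSorted
  have hW' := hW
  unfold BigWord at hW'
  have hN1 : 1 ≤ (n + 1) * (m + 1) := Nat.succ_le_of_lt (by positivity)
  have e1 : n * ((n + 1) * (m + 1)) * ((n + 1) * (m + 1)) +
      (n + 1) * (m + 1) * ((n + 1) * (m + 1)) =
      (n + 1) * ((n + 1) * (m + 1)) * ((n + 1) * (m + 1)) := by ring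
  have e2 := Nat.le_mul_of_pos_right (n * ((n + 1) * (m + 1))) hN1
  refine Runs.seq_loop (TableInv I (s.imem 3) (s.imem 4) (s.imem 8) (s.rmem 3)) _ _ ?_
    (fun i hi s' h' => ?_) fun s' h' => ?_
  · simp only [startTable, block, Prog.wp, IExp.Fits, IExp.eval, State.setI_ivar, h.fixed.size,
      h.fixed.codes, if_false, Nat.reduceEqDiff]
    repeat' apply And.intro
    all_goals try omega
    refine ⟨h.fixed.congr, ⟨by simp, by simp, by simp, by simp⟩,
      ⟨by simp [h.unused.imem_one], by simp [h.unused.imem_two], by simp [h.unused.imem_seven],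
        by simp [h.unused.rmem_two]⟩, by simp, by simp, by simp, fun j hj => ?_, fun j hj => ?_⟩
    all_goals
      have hrow : j / ((n + 1) * (m + 1)) / ((n + 1) * (m + 1)) = 0 := by
        rw [Nat.div_div_eq_div_mul]
        exact Nat.div_eq_of_lt hj
      simp [cell, hrow, dp, h.unused.imem_five, h.unused.imem_six]
  · refine ⟨?_, ?_, tableBody_runs_of_lt hW hS hi h'⟩
    · simp only [entryTest, Test.Fits, IExp.Fits, h'.counter, h'.limit]
      omega
    · simpa only [entryTest, Test.Holds, IExp.eval, h'.counter, h'.limit] using hi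
  · refine ⟨?_, ?_, h'⟩
    · simp only [entryTest, Test.Fits, IExp.Fits, h'.counter, h'.limit]
      omega
    · simp only [entryTest, Test.Holds, IExp.eval, h'.counter, h'.limit, lt_irrefl,
        not_false_eq_true]

theorem sweepPhase_runs (hW : BigWord n m W) {I : ColoredPoints n m} {ord yr ck : ℕ → ℕ}
    {S : ℕ → ℝ} (hS : IsSorted I ord yr ck S) {s : State}
    (h : TableInv I ord yr ck S (n * ((n + 1) * (m + 1)) * ((n + 1) * (m + 1))) s) :
    Runs W sweepPhase s
      (startSweep.time + (n * (pointTest.cost + sweepTime n + 1) + (pointTest.cost + 1)))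
      (SweepMem I ord yr ck S n (Sweep.run I ord yr ck S n Sweep.init)) := by
  have hW' := hW
  unfold BigWord at hW'
  -- The intermediate state is characterized by its future: processing the remaining `n - j` points
  -- from it gives the final state of the sweep.
  refine Runs.seq_loop (fun j s => ∃ st, SweepMem I ord yr ck S j st s ∧
    Sweep.Valid I ord ck S (n - j) st ∧
    Sweep.run I ord yr ck S (n - j) st = Sweep.run I ord yr ck S n Sweep.init) n _ ?_
    (fun j hj s' h' => ?_) fun s' h' => ?_
  · simp only [startSweep, block, Prog.wp, IExp.Fits, IExp.eval]
    refine ⟨by omega, by omega, Sweep.init, ?_, .init, rfl⟩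
    refine ⟨h.fixed.congr, h.sorted.congr, fun k hk b hb t ht => ?_, by simp, by simp [Sweep.init],
      by simp [Sweep.init, h.noLabels.height], by simp [Sweep.init, h.noLabels.code],
      by simp [Sweep.init, h.noLabels.color], by simp [Sweep.init, h.noLabels.assign]⟩
    have hlt := index_lt (show k < n + 1 by omega) hb ht
    have := h.choice _ (hlt.trans_eq (by ring))
    rw [cell_index _ _ _ _ hb ht] at this
    simpa using this
  · obtain ⟨st, h1, h2, h3⟩ := h'
    obtain ⟨k, hk⟩ : ∃ k, j + k + 1 = n := ⟨n - j - 1, by omega⟩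
    have e1 : n - j = k + 1 := by omega
    have e2 : n - (j + 1) = k := by omega
    rw [e1] at h2 h3
    refine ⟨?_, ?_, (sweepBody_runs hW hS hk h2 h1).mono le_rfl fun s'' h'' =>
      ⟨_, h'', by rw [e2]; exact h2.step hS, by rw [e2]; exact h3⟩⟩
    · simp only [pointTest, Test.Fits, IExp.Fits, h1.counter, h1.fixed.size]
      omega
    · simpa only [pointTest, Test.Holds, IExp.eval, h1.counter, h1.fixed.size] using hj
  · obtain ⟨st, h1, h2, h3⟩ := h'
    rw [Nat.sub_self, Sweep.run] at h3
    refine ⟨?_, ?_, h3 ▸ h1⟩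
    · simp only [pointTest, Test.Fits, IExp.Fits, h1.counter, h1.fixed.size]
      omega
    · simp only [pointTest, Test.Holds, IExp.eval, h1.counter, h1.fixed.size, lt_irrefl,
        not_false_eq_true]

/-! ### Word size and running time. -/

theorem bigWord_pow (n m : ℕ) : BigWord n m ((n + m + 2) ^ 7) := by
  unfold BigWord
  set B := n + m + 2 with hB
  have hN : (n + 1) * (m + 1) ≤ B ^ 2 := by
    rw [sq]
    exact Nat.mul_le_mul (by omega) (by omega)
  have h1 : (n + 1) * ((n + 1) * (m + 1)) * ((n + 1) * (m + 1)) ≤ B ^ 5 :=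
    (Nat.mul_le_mul (Nat.mul_le_mul (show n + 1 ≤ B by omega) hN) hN).trans_eq (by ring)
  have h2 : B * 1 ≤ B * B ^ 4 := Nat.mul_le_mul_left _ (Nat.one_le_pow _ _ (by omega))
  -- The table has size at most `B ^ 5`; as `B ≥ 2`, two further powers absorb the linear terms.
  have h3 : 2 * 2 * B ^ 5 ≤ B * B * B ^ 5 :=
    Nat.mul_le_mul_right _ (Nat.mul_le_mul (by omega) (by omega))
  have h4 : B * B ^ 4 = B ^ 5 := by ring
  have h5 : B * B * B ^ 5 = B ^ 7 := by ring
  omega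

/-- For the quadratic phases, ranking and sweep. A point needs a color, so `m` is positive unless `n
= 0` and the factor `m ^ 2` does no harm. -/
theorem linear_time_le {n m : ℕ} (hm : 0 < n → 0 < m) (A B : ℕ) :
    n * (A + n * B) ≤ (A + B) * (n ^ 4 * m ^ 2 + 1) := by
  rcases Nat.eq_zero_or_pos n with rfl | hn
  · simp
  · have h2 : 1 ≤ m ^ 2 := Nat.one_le_pow _ _ (hm hn)
    have h3 : n ^ 2 ≤ n ^ 4 * m ^ 2 :=
      (Nat.pow_le_pow_right hn (by omega)).trans (Nat.le_mul_of_pos_right _ h2)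
    have h4 : n ≤ n ^ 2 := by nlinarith
    calc n * (A + n * B) = A * n + B * n ^ 2 := by ring
      _ ≤ A * n ^ 2 + B * n ^ 2 := by gcongr
      _ = (A + B) * n ^ 2 := by ring
      _ ≤ (A + B) * (n ^ 4 * m ^ 2 + 1) := by
        gcongr
        omega

theorem table_time_le {n m : ℕ} (hm : 0 < n → 0 < m) (A B : ℕ) :
    n * ((n + 1) * (m + 1)) * ((n + 1) * (m + 1)) * (A + n * B) ≤
      16 * (A + B) * (n ^ 4 * m ^ 2 + 1) := by
  rcases Nat.eq_zero_or_pos n with rfl | hn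
  · simp
  -- The square of this factor `4` is the constant `16`.
  · have h1 : (n + 1) * (m + 1) ≤ 2 * n * (2 * m) := by
      have := hm hn
      gcongr <;> omega
    have h2 : A + n * B ≤ n * (A + B) := by nlinarith
    calc n * ((n + 1) * (m + 1)) * ((n + 1) * (m + 1)) * (A + n * B)
        ≤ n * (2 * n * (2 * m)) * (2 * n * (2 * m)) * (n * (A + B)) := by gcongr
      _ = 16 * (A + B) * (n ^ 4 * m ^ 2) := by ring
      _ ≤ 16 * (A + B) * (n ^ 4 * m ^ 2 + 1) := by
        gcongr
        omega

/-- The constant of the running time. -/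
def timeConst : ℕ :=
  (initPart.time + startTable.time + startSweep.time + 2 * (pointTest.cost + 1) +
    (entryTest.cost + 1) + (Prog.iset 0 (.var 20)).time) +
  ((pointTest.cost + sortTime 0 + 1) + (sortTime 1 - sortTime 0)) +
  16 * ((entryTest.cost + entryTime 0 + 1) + (entryTime 1 - entryTime 0)) +
  ((pointTest.cost + sweepTime 0 + 1) + (sweepTime 1 - sweepTime 0))

/-- The time is affine in `n`, so its coefficients can be read off at `0` and `1` without evaluating
the cost of any program. -/
theorem sortTime_eq (n : ℕ) : sortTime n = sortTime 0 + n * (sortTime 1 - sortTime 0) := by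
  simp only [sortTime, Nat.zero_mul, Nat.one_mul]
  rw [Nat.sub_eq_of_eq_add (c := (Test.ilt (.var 3) (.var 0)).cost + compareBody.time + 1)]
  all_goals ring

theorem entryTime_eq (n : ℕ) : entryTime n = entryTime 0 + n * (entryTime 1 - entryTime 0) := by
  simp only [entryTime, Nat.zero_mul, Nat.one_mul]
  rw [Nat.sub_eq_of_eq_add (c := splitTest.cost + splitBody.time + 1)]
  all_goals ring

theorem sweepTime_eq (n : ℕ) : sweepTime n = sweepTime 0 + n * (sweepTime 1 - sweepTime 0) := by
  simp only [sweepTime, Nat.zero_mul, Nat.one_mul]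
  rw [Nat.sub_eq_of_eq_add (c := scanTest.cost + scanBody.time + 1)]
  all_goals ring

theorem labelProg_runs (I : ColoredPoints n m) :
    Runs ((n + m + 2) ^ 7) labelProg (inputState I) (timeConst * (n ^ 4 * m ^ 2 + 1))
      fun s => ∃ L : Labeling n m, Outputs s L ∧ I.IsOptimal L := by
  have hW := bigWord_pow n m
  have hm : 0 < n → 0 < m := fun hn => (Nat.zero_le _).trans_lt (I.color ⟨0, hn⟩).2
  refine Runs.mono (.seq ((sortPhase_runs hW I).mono le_rfl fun s₁ h₁ =>
    .seq ((tablePhase_runs hW h₁).mono le_rfl fun s₂ h₂ =>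
      .seq ((sweepPhase_runs hW h₁.isSorted h₂).mono le_rfl fun s₃ h₃ => .of_wp ?_)))) ?_
    fun _ h => h
  · obtain ⟨L, hL, e1, e2, e3, e4⟩ := Sweep.exists_isOptimal h₁.isSorted
    have hcnt := (Sweep.run_spec h₁.isSorted n Sweep.init .init).1.cnt_le
    simp only [block, Prog.wp, IExp.Fits, IExp.eval, h₃.cnt]
    refine ⟨?_, L, ⟨?_, fun i => ?_, fun l => ?_, fun l => ?_⟩, hL⟩
    · unfold BigWord at hW
      omega
    · simp [e1]
    · simp [h₃.assign, e2]
    · simp [h₃.color, e3]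
    · simp [h₃.height, e4]
  · have t1 := linear_time_le hm (pointTest.cost + sortTime 0 + 1) (sortTime 1 - sortTime 0)
    have t2 := table_time_le hm (entryTest.cost + entryTime 0 + 1) (entryTime 1 - entryTime 0)
    have t3 := linear_time_le hm (pointTest.cost + sweepTime 0 + 1) (sweepTime 1 - sweepTime 0)
    have e1 : pointTest.cost + sortTime n + 1 =
        pointTest.cost + sortTime 0 + 1 + n * (sortTime 1 - sortTime 0) := by
      rw [sortTime_eq n]
      ring
    have e2 : entryTest.cost + entryTime n + 1 =
        entryTest.cost + entryTime 0 + 1 + n * (entryTime 1 - entryTime 0) := by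
      rw [entryTime_eq n]
      ring
    have e3 : pointTest.cost + sweepTime n + 1 =
        pointTest.cost + sweepTime 0 + 1 + n * (sweepTime 1 - sweepTime 0) := by
      rw [sweepTime_eq n]
      ring
    rw [e1, e2, e3]
    have t0 := Nat.le_mul_of_pos_right (initPart.time + startTable.time + startSweep.time +
      2 * (pointTest.cost + 1) + (entryTest.cost + 1) + (Prog.iset 0 (.var 20)).time)
      (Nat.succ_pos (n ^ 4 * m ^ 2))
    have hb : (block [.iset 0 (.var 20)]).time = (Prog.iset 0 (.var 20)).time := rfl
    rw [hb, timeConst]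
    simp only [Nat.succ_eq_add_one] at t0
    generalize sortTime 1 - sortTime 0 = a₁ at *
    generalize entryTime 1 - entryTime 0 = a₂ at *
    generalize sweepTime 1 - sweepTime 0 = a₃ at *
    linarith

end Backbone

/-- One program computes, on words of `O(log (n + m))` bits, a crossing-free labeling with the
minimum number of finite backbones for every input with `n` points and `m` colors, in time
`O(n ^ 4 * m ^ 2)` (where `+ 1` matters for `n = 0` only). -/
theorem mainTheorem3 :
    ∃ (prog : Backbone.Prog) (K d : ℕ), ∀ (n m : ℕ) (I : Backbone.ColoredPoints n m),
      ∃ (t : ℕ) (s : Backbone.State) (L : Backbone.Labeling n m),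
        Backbone.Exec ((n + m + 2) ^ d) prog (Backbone.inputState I) t s ∧
        t ≤ K * (n ^ 4 * m ^ 2 + 1) ∧
        Backbone.Outputs s L ∧ I.IsOptimal L := by
  refine ⟨Backbone.labelProg, Backbone.timeConst, 7, fun n m I => ?_⟩
  obtain ⟨t, s, h1, h2, L, h3, h4⟩ := Backbone.labelProg_runs I
  exact ⟨t, s, L, h1, h2, h3, h4⟩
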